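/- Setting. Let $X$ be a locally compact separable Hausdorff space and $m$ a Borel measure on $X$ that is finite on compact sets and positive on non-empty open sets. Let $(a,D[a])$ be a Dirichlet form on $L^2(X,m)$, i.e. a symmetric non-negative bilinear form on a dense subspace $D[a]$, complete for the intrinsic norm $\|u\|_a=(a[u,u]+(u,u))^{1/2}$, and such that $u\in D[a]$ implies $v=\min\{1,\max\{u,0\}\}\in D[a]$ and $a[v,v]\le a[u,u]$. Assume that it is strongly local: $a[u,v]=0$ whenever $u$ is a.e. constant on the support of $v$. Assume further: (a1) the embedding $D[a]\hookrightarrow L^2(X,m)$ is compact; (a2) for every compact $K$ and every relatively compact open $G\supset K$ there is $u\in D[a]$ with $u=1$ on $K$ and $u=0$ on $X\setminus G$; (a3) $C(X)\cap D[a]$ is dense in $D[a]$ for the intrinsic norm and in $C(X)$ for uniform convergence on compact sets. For open $G$ let $\mathrm{Cap}(G)=\inf\{a[u,u]+(u,u): u\in D[a],\ u\ge 1 \text{ a.e. on } G\}$, and for arbitrary $A$ let $\mathrm{Cap}(A)$ be the infimum of $\mathrm{Cap}(G)$ over open $G\supset A$. A function $g:X\to\mathbb R$ is quasi-continuous if for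 every $\varepsilon>0$ there is an open $G$ with $\mathrm{Cap}(G)<\varepsilon$ such that $g|_{X\setminus G}$ is continuous. An energy measure of the form is a symmetric bilinear map $(u,v)\mapsto\mu[u,v]$ from $D[a]\times D[a]$ to signed Borel measures such that: each $\mu[u,u]$ is non-negative and regular; $a[u,v]=\int_X\mu[u,v](dx)$ for all $u,v\in D[a]$; $\int\varphi\,\mu[u,u](dx)=a[u\varphi,u]-\frac12a[u^2,\varphi]$ for bounded $u\in D[a]$ and $\varphi\in D[a]\cap C_c(X)$; and $\chi_A\mu[u,u]=\chi_A\mu[v,v]$ whenever $u=v$ $m$-a.e. on an open set $A$. Theorem. Let $\psi:X\to\mathbb R$ be quasi-continuous, let $K_\psi=\{v\in D[a]: v\ge\psi\ m\text{-a.e.}\}$, and let $f$ be a bounded linear functional on $(D[a],\|\cdot\|_a)$. Assume that the obstacle problem $$u\in K_\psi,\qquad a[u,v-u]\ge\langle f,v-u\rangle\quad\text{for all } v\in K_\psi$$ has a unique solution $\tilde u$. Take any quasi-continuous version of $\tilde u$, denoted by the same letter, and let $I=\{x\in X:\tilde u(x)=\psi(x)\}$. 1. $L\tilde u=f$ on $X\setminus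 I$, that is, $a[\tilde u,\zeta]=\langle f,\zeta\rangle$ for every $\zeta\in D[a]$ that vanishes a.e. outside some compact subset of $X\setminus I$; and, more generally ($I$ need not be closed), for every $\zeta\in D[a]$ that vanishes a.e. outside some compact subset of $X$ and has a quasi-continuous version that vanishes on $I$ outside a set of capacity zero. 2. If moreover $\psi$ is equal to a constant function, then $L\tilde u=0$ on $I$, that is, for every energy measure $\mu$ of the form and every $v\in D[a]$, the function $\chi_I$ is $\mu[\tilde u,v]$-integrable and $$\int_X\chi_I(x)\,\mu[\tilde u,v](dx)=0 .$$ -/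

import Mathlib

open MeasureTheory Filter Topology Set
open scoped ENNReal

/-- A Dirichlet form `(a, D[a])` on the real Hilbert space `L²(X, m)`: a symmetric non-negative
bilinear form on a dense subspace which is complete for the intrinsic norm
`(a[u,u] + (u,u))^{1/2}` and on which the unit contraction operates. -/
structure DirichletForm {X : Type*} [MeasurableSpace X] (m : Measure X) where
  /-- the domain `D[a]` -/
  domain : Submodule ℝ (Lp ℝ 2 m)
  /-- the bilinear form `a[u,v]` -/
  form : domain →ₗ[ℝ] domain →ₗ[ℝ] ℝ
  dense_domain : Dense (domain : Set (Lp ℝ 2 m))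
  symm : ∀ u v : domain, form u v = form v u
  nonneg : ∀ u : domain, 0 ≤ form u u
  complete : ∀ u : ℕ → domain,
    (∀ ε : ℝ, 0 < ε → ∃ N : ℕ, ∀ i ≥ N, ∀ j ≥ N,
      form (u i - u j) (u i - u j)
        + inner ℝ ((u i - u j : domain) : Lp ℝ 2 m) ((u i - u j : domain) : Lp ℝ 2 m) < ε) →
    ∃ v : domain, Tendsto (fun i => form (u i - v) (u i - v)
        + inner ℝ ((u i - v : domain) : Lp ℝ 2 m) ((u i - v : domain) : Lp ℝ 2 m)) atTop (𝓝 0)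
  markov : ∀ u : domain, ∃ v : domain,
    (∀ᵐ x ∂m, (v : Lp ℝ 2 m) x = min 1 (max ((u : Lp ℝ 2 m) x) 0)) ∧ form v v ≤ form u u

namespace DirichletForm

section Basic

variable {X : Type*} [MeasurableSpace X] {m : Measure X}

/-- The square `a[u,u] + (u,u)` of the intrinsic norm. -/
noncomputable def energyOne (E : DirichletForm m) (u : E.domain) : ℝ :=
  E.form u u + inner ℝ (u : Lp ℝ 2 m) (u : Lp ℝ 2 m)

/-- A linear functional on `D[a]` belongs to the dual `D[a]'`: it is bounded for the intrinsic
norm. -/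
def IsBoundedFunctional (E : DirichletForm m) (f : E.domain →ₗ[ℝ] ℝ) : Prop :=
  ∃ C : ℝ, ∀ v : E.domain, |f v| ≤ C * Real.sqrt (E.energyOne v)

/-- The functional `L u : v ↦ a[u,v]` on `D[a]`. -/
def gen (E : DirichletForm m) (u : E.domain) : E.domain →ₗ[ℝ] ℝ := E.form u

/-- (a1): the embedding of `D[a]`, with its intrinsic norm, into `L²(X, m)` is compact. -/
def CompactEmbedding (E : DirichletForm m) : Prop :=
  ∀ u : ℕ → E.domain, (∃ C : ℝ, ∀ n, E.energyOne (u n) ≤ C) →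
    ∃ (k : ℕ → ℕ) (v : Lp ℝ 2 m), StrictMono k ∧
      Tendsto (fun n => (u (k n) : Lp ℝ 2 m)) atTop (𝓝 v)

/-- The convex set `K_ψ = {v ∈ D[a] : v ≥ ψ m-a.e.}`. -/
def obstacleSet (E : DirichletForm m) (ψ : X → ℝ) : Set E.domain :=
  {v | ∀ᵐ x ∂m, ψ x ≤ (v : Lp ℝ 2 m) x}

/-- `u` solves the obstacle problem: `u ∈ K_ψ` and `a[u, v - u] ≥ ⟨f, v - u⟩` for all
`v ∈ K_ψ`. -/
def IsObstacleSolution (E : DirichletForm m) (ψ : X → ℝ) (f : E.domain →ₗ[ℝ] ℝ)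
    (u : E.domain) : Prop :=
  u ∈ E.obstacleSet ψ ∧ ∀ v ∈ E.obstacleSet ψ, f (v - u) ≤ E.form u (v - u)

end Basic

section Topological

variable {X : Type*} [TopologicalSpace X] [MeasurableSpace X] {m : Measure X}

/-- The (closed) support of an element `v` of `D[a]`: the points all of whose neighbourhoods meet
`{v ≠ 0}` in a set of positive measure. -/
def supp (E : DirichletForm m) (v : E.domain) : Set X :=
  (m.restrict {x | (v : Lp ℝ 2 m) x ≠ 0}).support

/-- `a[u,v] = 0` whenever `u` is (a.e.) constant on the support of `v`. -/
def StronglyLocal (E : DirichletForm m) : Prop :=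
  ∀ u v : E.domain, (∃ c : ℝ, ∀ᵐ x ∂m, x ∈ E.supp v → (u : Lp ℝ 2 m) x = c) → E.form u v = 0

/-- (a2): for every compact `K` and relatively compact open `G ⊇ K` there is `u ∈ D[a]` with
`u = 1` on `K` and `u = 0` on `X \ G`. -/
def UrysohnProperty (E : DirichletForm m) : Prop :=
  ∀ K G : Set X, IsCompact K → IsOpen G → IsCompact (closure G) → K ⊆ G →
    ∃ u : E.domain, (∀ᵐ x ∂m, x ∈ K → (u : Lp ℝ 2 m) x = 1) ∧
      (∀ᵐ x ∂m, x ∉ G → (u : Lp ℝ 2 m) x = 0)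

/-- (a3): `C(X) ∩ D[a]` is dense in `D[a]` for the intrinsic norm, and dense in `C(X)` for
uniform convergence on compact sets. -/
def ContinuousCore (E : DirichletForm m) : Prop :=
  (∀ u : E.domain, ∀ ε : ℝ, 0 < ε → ∃ (v : E.domain) (g : X → ℝ), Continuous g ∧
    (∀ᵐ x ∂m, (v : Lp ℝ 2 m) x = g x) ∧ E.energyOne (u - v) < ε) ∧
  (∀ h : X → ℝ, Continuous h → ∀ K : Set X, IsCompact K → ∀ ε : ℝ, 0 < ε →
    ∃ (v : E.domain) (g : X → ℝ), Continuous g ∧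
      (∀ᵐ x ∂m, (v : Lp ℝ 2 m) x = g x) ∧ ∀ x ∈ K, |g x - h x| < ε)

/-- The capacity of an open set: the infimum of `a[u,u] + (u,u)` over all `u ∈ D[a]` with
`u ≥ 1` a.e. on the set (`∞` if there is no such `u`). -/
noncomputable def openCapacity (E : DirichletForm m) (G : Set X) : ℝ≥0∞ :=
  ⨅ (u : E.domain) (_ : ∀ᵐ x ∂m, x ∈ G → 1 ≤ (u : Lp ℝ 2 m) x), ENNReal.ofReal (E.energyOne u)

/-- The capacity of an arbitrary set: the infimum of the capacities of its open supersets. -/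
noncomputable def capacity (E : DirichletForm m) (A : Set X) : ℝ≥0∞ :=
  ⨅ (G : Set X) (_ : IsOpen G) (_ : A ⊆ G), E.openCapacity G

/-- `g` is quasi-continuous: it is continuous on the complements of open sets of arbitrarily small
capacity. -/
def QuasiContinuous (E : DirichletForm m) (g : X → ℝ) : Prop :=
  ∀ ε : ℝ≥0∞, 0 < ε → ∃ G : Set X, IsOpen G ∧ E.capacity G < ε ∧ ContinuousOn g Gᶜ

/-- `g` is a quasi-continuous version of the element `u` of `D[a]`. -/
def IsQuasiContinuousVersion (E : DirichletForm m) (g : X → ℝ) (u : E.domain) : Prop :=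
  E.QuasiContinuous g ∧ ∀ᵐ x ∂m, (u : Lp ℝ 2 m) x = g x

/-- `F = G` on `X \ I`: the functionals `F` and `G` agree on all `ζ ∈ D[a]` which vanish
a.e. outside a compact subset of `X \ I`. -/
def EqOffSet (E : DirichletForm m) (F G : E.domain →ₗ[ℝ] ℝ) (I : Set X) : Prop :=
  ∀ ζ : E.domain, (∃ K : Set X, IsCompact K ∧ Disjoint K I ∧
    ∀ᵐ x ∂m, x ∉ K → (ζ : Lp ℝ 2 m) x = 0) → F ζ = G ζ

/-- `F = G` on `X \ I` in the quasi-everywhere sense, suited to a set `I` which need not be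
closed: `F` and `G` agree on all `ζ ∈ D[a]` which vanish a.e. outside a compact subset of `X`
and have a quasi-continuous version that vanishes on `I` up to a set of capacity zero. -/
def QuasiEqOffSet (E : DirichletForm m) (F G : E.domain →ₗ[ℝ] ℝ) (I : Set X) : Prop :=
  ∀ ζ : E.domain, (∃ K : Set X, IsCompact K ∧ ∀ᵐ x ∂m, x ∉ K → (ζ : Lp ℝ 2 m) x = 0) →
    (∃ z : X → ℝ, E.IsQuasiContinuousVersion z ζ ∧ E.capacity {x ∈ I | z x ≠ 0} = 0) →
    F ζ = G ζ

/-- `μ` is the energy measure of the form: a symmetric non-negative bilinear map into the signed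
Borel measures with `a[u,v] = ∫ dμ[u,v]` and with the localization property, given on bounded `u`
by `∫ φ dμ[u,u] = a[uφ,u] - a[u²,φ]/2` for `φ ∈ D[a] ∩ C_c(X)`. Regularity is automatic when `X`
has a countable base. -/
structure IsEnergyMeasure (E : DirichletForm m)
    (μ : E.domain →ₗ[ℝ] E.domain →ₗ[ℝ] SignedMeasure X) : Prop where
  symm : ∀ u v : E.domain, μ u v = μ v u
  nonneg : ∀ (u : E.domain) (B : Set X), 0 ≤ μ u u B
  regular : ∀ u : E.domain, (μ u u).variation.Regular
  total : ∀ u v : E.domain, E.form u v = μ u v univ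
  formula : ∀ u φ w z : E.domain, ∀ g : X → ℝ,
    (∃ M : ℝ, ∀ᵐ x ∂m, |(u : Lp ℝ 2 m) x| ≤ M) →
    Continuous g → HasCompactSupport g → (∀ᵐ x ∂m, (φ : Lp ℝ 2 m) x = g x) →
    (∀ᵐ x ∂m, (w : Lp ℝ 2 m) x = (u : Lp ℝ 2 m) x * (φ : Lp ℝ 2 m) x) →
    (∀ᵐ x ∂m, (z : Lp ℝ 2 m) x = (u : Lp ℝ 2 m) x ^ 2) →
    ∫ᵛ x, g x ∂<•(μ u u) = E.form w u - E.form z φ / 2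
  localization : ∀ (A : Set X) (u v : E.domain), IsOpen A →
    (∀ᵐ x ∂m, x ∈ A → (u : Lp ℝ 2 m) x = (v : Lp ℝ 2 m) x) →
    ∀ B : Set X, MeasurableSet B → μ u u (A ∩ B) = μ v v (A ∩ B)

end Topological

end DirichletForm

/-!
# The obstacle problem for strongly local Dirichlet forms

Both parts rest on one approximation device. A quasi-continuous function `g` is continuous off an
open set `A` of small capacity, and smallness of the capacity provides a potential `e ∈ D[a]` of
small energy with `0 ≤ e ≤ 1` and `e = 1` on `A`. Given `u ∈ D[a]` and a level `c ≥ 0`, truncations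
of `u` shifted by multiples of `e` are bounded elements of `D[a]` of bounded energy, which converge
to `u` in `L²` and are exactly constant on `A` and where `u` is near `c` (`flatten`, `flat`). By a
Mazur type argument (`exists_domain_eq_of_tendsto`) the element `u` is an energy limit of convex
combinations of them. Hence a convex set that contains all such flattened elements has `u` in its
closure for the energy norm (`exists_mem_energyOne_sub_lt_of_flat`). Only the unit contraction
enters, so no general theory of normal contractions is needed.

*The equation off the coincidence set.* The flattening principle is applied to the test function
`ζ`, at the level `0`, and to the kernel of the bounded functional `L u - f`. The flattened test
functions are bounded and vanish on `A` and where `ζ` is small. On the remaining set, compactness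
and continuity off `A` give `u ≥ ψ + δ` with some `δ > 0`; thus `u ± t v` are admissible competitors
for small `t > 0`, and the variational inequality becomes an equation
(`IsObstacleSolution.form_eq`).

*The energy measure of the coincidence set.* For a constant obstacle `c` the coincidence set is a
level set of a quasi-continuous version of `u`. The principle is applied to `u` and to the elements
whose energy measure does not charge the level set. A flattened element `v` is constant on an open
neighbourhood of the level set, so that by strong locality both terms of
`∫ φ dμ[v,v] = a[vφ,v] - a[v²,φ]/2` vanish for cut-off functions `φ` supported there, and
`μ[v,v]` vanishes on this neighbourhood by regularity (`variation_eq_zero_of_ae_eq_const`). This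
property survives convex combinations, by the Cauchy-Schwarz inequality, and energy limits, since
`μ[w,w] ≤ a[w,w]`. The formula needs `v² ∈ D[a]`, which follows by writing the square as a limit of
averages of the functions `(v - r)⁺`.
-/

namespace DirichletForm

/-! ### The energy norm -/

section Energy

variable {X : Type*} [MeasurableSpace X] {m : Measure X}

lemma energyOne_nonneg (E : DirichletForm m) (u : E.domain) : 0 ≤ E.energyOne u :=
  add_nonneg (E.nonneg u) real_inner_self_nonneg

lemma norm_sq_le_energyOne (E : DirichletForm m) (u : E.domain) :
    ‖(u : Lp ℝ 2 m)‖ ^ 2 ≤ E.energyOne u := by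
  rw [energyOne, real_inner_self_eq_norm_sq]
  linarith [E.nonneg u]

lemma energyOne_smul_add_smul (E : DirichletForm m) (a b : ℝ) (u v : E.domain) :
    E.energyOne (a • u + b • v) =
      a ^ 2 * E.energyOne u + b ^ 2 * E.energyOne v
        + 2 * a * b * (E.form u v + inner ℝ (u : Lp ℝ 2 m) (v : Lp ℝ 2 m)) := by
  simp only [energyOne, map_add, map_smul, LinearMap.add_apply, LinearMap.smul_apply, smul_eq_mul,
    Submodule.coe_add, Submodule.coe_smul, inner_add_left, inner_add_right, inner_smul_left,
    inner_smul_right, RCLike.conj_to_real]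
  rw [E.symm v u, real_inner_comm (u : Lp ℝ 2 m) (v : Lp ℝ 2 m)]
  ring

lemma energyOne_smul (E : DirichletForm m) (a : ℝ) (u : E.domain) :
    E.energyOne (a • u) = a ^ 2 * E.energyOne u := by
  simpa using E.energyOne_smul_add_smul a 0 u 0

lemma energyOne_add_add_sub (E : DirichletForm m) (u v : E.domain) :
    E.energyOne (u + v) + E.energyOne (u - v) = 2 * E.energyOne u + 2 * E.energyOne v := by
  have h1 := E.energyOne_smul_add_smul 1 1 u v
  have h2 := E.energyOne_smul_add_smul 1 (-1) u v
  simp only [one_smul, neg_smul, ← sub_eq_add_neg] at h1 h2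
  rw [h1, h2]
  ring

lemma energyOne_add_le (E : DirichletForm m) (u v : E.domain) :
    E.energyOne (u + v) ≤ 2 * E.energyOne u + 2 * E.energyOne v := by
  linarith [E.energyOne_add_add_sub u v, E.energyOne_nonneg (u - v)]

lemma energyOne_sub_le (E : DirichletForm m) (u v : E.domain) :
    E.energyOne (u - v) ≤ 2 * E.energyOne u + 2 * E.energyOne v := by
  linarith [E.energyOne_add_add_sub u v, E.energyOne_nonneg (u + v)]

lemma energyOne_neg (E : DirichletForm m) (u : E.domain) :
    E.energyOne (-u) = E.energyOne u := by
  simpa using E.energyOne_smul (-1) u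

lemma convexOn_energyOne (E : DirichletForm m) : ConvexOn ℝ univ E.energyOne := by
  refine ⟨convex_univ, fun u _ v _ a b ha hb hab => ?_⟩
  have h1 := E.energyOne_smul_add_smul a b u v
  have h2 := E.energyOne_smul_add_smul 1 (-1) u v
  have h3 := mul_nonneg (mul_nonneg ha hb) (E.energyOne_nonneg ((1 : ℝ) • u + (-1 : ℝ) • v))
  rw [h2] at h3
  obtain rfl : b = 1 - a := by linarith
  rw [h1, smul_eq_mul, smul_eq_mul]
  linarith

/-- A convex set of domain elements is closed under `L²`-limits of sequences of bounded energy, up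
to closure in the energy norm. This replaces weak compactness together with Mazur's lemma: elements
of almost minimal energy among those elements of `S` which are `L²`-close to the limit form a Cauchy
sequence in the energy norm, by the parallelogram law. -/
theorem exists_domain_eq_of_tendsto (E : DirichletForm m) {S : Set E.domain} (hS : Convex ℝ S)
    {y : ℕ → E.domain} (hyS : ∀ n, y n ∈ S) {C : ℝ} (hC : ∀ n, E.energyOne (y n) ≤ C)
    {w : Lp ℝ 2 m} (hw : Tendsto (fun n => (y n : Lp ℝ 2 m)) atTop (𝓝 w)) :
    ∃ v : E.domain, (v : Lp ℝ 2 m) = w ∧ ∀ ε : ℝ, 0 < ε → ∃ s ∈ S, E.energyOne (s - v) < ε := by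
  let δ : ℕ → ℝ := fun n => 1 / ((n : ℝ) + 1)
  have hδ : ∀ n, 0 < δ n := fun n => by positivity
  have hδ0 : Tendsto δ atTop (𝓝 0) := tendsto_one_div_add_atTop_nhds_zero_nat
  have hδanti : ∀ i j : ℕ, i ≤ j → δ j ≤ δ i := fun i j hij => by
    apply one_div_le_one_div_of_le (by positivity)
    have : (i : ℝ) ≤ j := by exact_mod_cast hij
    linarith
  let T : ℕ → Set E.domain := fun n => {s | s ∈ S ∧ ‖(s : Lp ℝ 2 m) - w‖ ≤ δ n}
  have hTanti : ∀ i j : ℕ, i ≤ j → T j ⊆ T i := fun i j hij s hs =>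
    ⟨hs.1, hs.2.trans (hδanti i j hij)⟩
  have hTne : ∀ n, ∃ s ∈ T n, E.energyOne s ≤ C := fun n => by
    have h := (Metric.tendsto_nhds.1 hw (δ n) (hδ n)).exists
    obtain ⟨k, hk⟩ := h
    refine ⟨y k, ⟨hyS k, ?_⟩, hC k⟩
    rw [dist_eq_norm] at hk
    exact hk.le
  have hTmid : ∀ n, ∀ s ∈ T n, ∀ t ∈ T n, (1 / 2 : ℝ) • s + (1 / 2 : ℝ) • t ∈ T n := by
    intro n s hs t ht
    refine ⟨hS hs.1 ht.1 (by norm_num) (by norm_num) (by norm_num), ?_⟩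
    have : (((1 / 2 : ℝ) • s + (1 / 2 : ℝ) • t : E.domain) : Lp ℝ 2 m) - w
        = (1 / 2 : ℝ) • ((s : Lp ℝ 2 m) - w) + (1 / 2 : ℝ) • ((t : Lp ℝ 2 m) - w) := by
      simp only [Submodule.coe_add, Submodule.coe_smul]
      module
    rw [this]
    refine (norm_add_le _ _).trans ?_
    rw [norm_smul, norm_smul]
    have h1 := hs.2
    have h2 := ht.2
    norm_num
    linarith
  let d : ℕ → ℝ := fun n => sInf (E.energyOne '' T n)
  have hbdd : ∀ n, BddBelow (E.energyOne '' T n) := fun n =>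
    ⟨0, by rintro _ ⟨s, -, rfl⟩; exact E.energyOne_nonneg s⟩
  have hne : ∀ n, (E.energyOne '' T n).Nonempty := fun n => by
    obtain ⟨s, hs, -⟩ := hTne n
    exact ⟨_, s, hs, rfl⟩
  have hdle : ∀ n, ∀ s ∈ T n, d n ≤ E.energyOne s := fun n s hs =>
    csInf_le (hbdd n) ⟨s, hs, rfl⟩
  have hdC : ∀ n, d n ≤ C := fun n => by
    obtain ⟨s, hs, hsC⟩ := hTne n
    exact (hdle n s hs).trans hsC
  have hdmono : Monotone d := fun i j hij =>
    csInf_le_csInf (hbdd i) (hne j) (image_mono (hTanti i j hij))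
  have hdlim : Tendsto d atTop (𝓝 (⨆ n, d n)) :=
    tendsto_atTop_ciSup hdmono ⟨C, by rintro _ ⟨n, rfl⟩; exact hdC n⟩
  have hdsup : ∀ n, d n ≤ ⨆ n, d n := fun n =>
    le_ciSup (f := d) ⟨C, by rintro _ ⟨n, rfl⟩; exact hdC n⟩ n
  have hex : ∀ n, ∃ s ∈ T n, E.energyOne s < d n + δ n := fun n => by
    obtain ⟨_, ⟨s, hs, rfl⟩, hlt⟩ := exists_lt_of_csInf_lt (hne n)
      (show sInf (E.energyOne '' T n) < d n + δ n from lt_add_of_pos_right _ (hδ n))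
    exact ⟨s, hs, hlt⟩
  choose x hxT hxd using hex
  obtain ⟨v, hv⟩ := E.complete x (by
    intro ε hε
    have h1 : Tendsto (fun n => 4 * ((⨆ n, d n) - d n + δ n)) atTop (𝓝 0) := by
      have := ((tendsto_const_nhds (x := ⨆ n, d n)).sub hdlim).add hδ0
      simpa using this.const_mul 4
    obtain ⟨N, hN⟩ := ((tendsto_order.1 h1).2 ε hε).exists
    refine ⟨N, fun i hi j hj => ?_⟩
    change E.energyOne (x i - x j) < ε
    have hmid := hdle N _ (hTmid N _ (hTanti N i hi (hxT i)) _ (hTanti N j hj (hxT j)))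
    rw [← smul_add, energyOne_smul] at hmid
    have hpar := E.energyOne_add_add_sub (x i) (x j)
    linarith [hxd i, hxd j, hdsup i, hdsup j, hδanti N i hi, hδanti N j hj])
  have hv' : Tendsto (fun n => E.energyOne (x n - v)) atTop (𝓝 0) := hv
  refine ⟨v, ?_, fun ε hε => ?_⟩
  · have hxw : Tendsto (fun n => (x n : Lp ℝ 2 m)) atTop (𝓝 w) := by
      rw [tendsto_iff_norm_sub_tendsto_zero]
      exact squeeze_zero (fun n => norm_nonneg _) (fun n => (hxT n).2) hδ0
    have hxv : Tendsto (fun n => (x n : Lp ℝ 2 m)) atTop (𝓝 (v : Lp ℝ 2 m)) := by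
      rw [tendsto_iff_norm_sub_tendsto_zero]
      have h0 : Tendsto (fun n => Real.sqrt (E.energyOne (x n - v))) atTop (𝓝 0) := by
        simpa using hv'.sqrt
      exact squeeze_zero (fun n => norm_nonneg _)
        (fun n => Real.le_sqrt_of_sq_le (E.norm_sq_le_energyOne (x n - v))) h0
    exact tendsto_nhds_unique hxv hxw
  · obtain ⟨n, hn⟩ := ((tendsto_order.1 hv').2 ε hε).exists
    exact ⟨x n, (hxT n).1, hn⟩

end Energy

/-! ### Truncation and dominated convergence -/

section Truncation

variable {X : Type*} [MeasurableSpace X] {m : Measure X}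

/-- Dominated convergence in `L²`. -/
lemma _root_.MeasureTheory.Lp.tendsto_two_of_dominated {y : ℕ → Lp ℝ 2 m} {w : Lp ℝ 2 m}
    {b : X → ℝ} (hb : MemLp b 2 m) (hyb : ∀ n, ∀ᵐ x ∂m, |y n x| ≤ b x)
    (hlim : ∀ᵐ x ∂m, Tendsto (fun n => y n x) atTop (𝓝 (w x))) :
    Tendsto y atTop (𝓝 w) := by
  have hwb : ∀ᵐ x ∂m, |w x| ≤ b x := by
    filter_upwards [ae_all_iff.2 hyb, hlim] with x h1 h2
    exact le_of_tendsto h2.abs (Eventually.of_forall h1)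
  have hsq : ∀ n, ‖y n - w‖ ^ 2 = ∫ x, (y n x - w x) ^ 2 ∂m := fun n => by
    rw [← real_inner_self_eq_norm_sq, L2.inner_def]
    refine integral_congr_ae ?_
    filter_upwards [Lp.coeFn_sub (y n) w] with x hx
    rw [hx]
    simp [pow_two]
  have hint : Tendsto (fun n => ∫ x, (y n x - w x) ^ 2 ∂m) atTop (𝓝 (∫ _, (0 : ℝ) ∂m)) := by
    refine tendsto_integral_of_dominated_convergence (fun x => 4 * b x ^ 2) ?_ ?_ ?_ ?_
    · exact fun n => ((Lp.aestronglyMeasurable _).sub (Lp.aestronglyMeasurable _)).pow 2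
    · exact hb.integrable_sq.const_mul 4
    · intro n
      filter_upwards [hyb n, hwb] with x h1 h2
      rw [Real.norm_eq_abs, abs_of_nonneg (sq_nonneg _)]
      have h3 : |y n x - w x| ≤ 2 * b x := (abs_sub _ _).trans (by linarith)
      calc (y n x - w x) ^ 2 = |y n x - w x| ^ 2 := (sq_abs _).symm
        _ ≤ (2 * b x) ^ 2 := pow_le_pow_left₀ (abs_nonneg _) h3 2
        _ = 4 * b x ^ 2 := by ring
    · filter_upwards [hlim] with x hx
      simpa using (hx.sub_const (w x)).pow 2
  rw [tendsto_iff_norm_sub_tendsto_zero]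
  have : Tendsto (fun n => Real.sqrt (‖y n - w‖ ^ 2)) atTop (𝓝 0) := by
    simp_rw [hsq]
    simpa using hint.sqrt
  simpa using this

lemma exists_clamp (E : DirichletForm m) (b : ℝ) (u : E.domain) :
    ∃ v : E.domain, (0 ≤ b → ∀ᵐ x ∂m, (v : Lp ℝ 2 m) x = min b (max ((u : Lp ℝ 2 m) x) 0)) ∧
      E.energyOne v ≤ E.energyOne u := by
  rcases le_or_gt b 0 with hb | hb
  · refine ⟨0, fun hb' => ?_, by simpa [energyOne] using E.energyOne_nonneg u⟩
    obtain rfl : b = 0 := le_antisymm hb hb'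
    filter_upwards [Lp.coeFn_zero ℝ 2 m] with x hx
    change (0 : Lp ℝ 2 m) x = _
    rw [hx]
    simp
  obtain ⟨v, hv, hvu⟩ := E.markov (b⁻¹ • u)
  have key : ∀ᵐ x ∂m, ((b • v : E.domain) : Lp ℝ 2 m) x
      = min b (max ((u : Lp ℝ 2 m) x) 0) := by
    filter_upwards [hv, Lp.coeFn_smul b (v : Lp ℝ 2 m), Lp.coeFn_smul b⁻¹ (u : Lp ℝ 2 m)]
      with x h1 h2 h3
    rw [Submodule.coe_smul, h2, Pi.smul_apply, h1, Submodule.coe_smul, h3, Pi.smul_apply,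
      smul_eq_mul, smul_eq_mul, mul_min_of_nonneg _ _ hb.le, mul_max_of_nonneg _ _ hb.le,
      mul_inv_cancel_left₀ hb.ne', mul_one, mul_zero]
  refine ⟨b • v, fun _ => key, ?_⟩
  have hnorm : ‖((b • v : E.domain) : Lp ℝ 2 m)‖ ≤ ‖(u : Lp ℝ 2 m)‖ := by
    refine Lp.norm_le_norm_of_ae_le ?_
    filter_upwards [key] with x hx
    rw [hx, Real.norm_eq_abs, Real.norm_eq_abs,
      abs_of_nonneg (le_min hb.le (le_max_right _ _))]
    exact (min_le_right _ _).trans (max_le (le_abs_self _) (abs_nonneg _))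
  have hform : E.form (b • v) (b • v) ≤ E.form u u := by
    simp only [map_smul, LinearMap.smul_apply, smul_eq_mul] at hvu ⊢
    have := mul_le_mul_of_nonneg_left hvu (mul_nonneg hb.le hb.le)
    have e : b * b * (b⁻¹ * (b⁻¹ * E.form u u)) = E.form u u := by field_simp
    linarith
  rw [energyOne, energyOne, real_inner_self_eq_norm_sq, real_inner_self_eq_norm_sq]
  exact add_le_add hform (pow_le_pow_left₀ (norm_nonneg _) hnorm 2)

/-- The truncation `min b (max u 0)` of `u` to `[0, b]`, as an element of the domain; meaningful for
`0 ≤ b`. -/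
noncomputable def clamp (E : DirichletForm m) (b : ℝ) (u : E.domain) : E.domain :=
  (E.exists_clamp b u).choose

lemma coeFn_clamp (E : DirichletForm m) {b : ℝ} (hb : 0 ≤ b) (u : E.domain) :
    ∀ᵐ x ∂m, (E.clamp b u : Lp ℝ 2 m) x = min b (max ((u : Lp ℝ 2 m) x) 0) :=
  (E.exists_clamp b u).choose_spec.1 hb

lemma energyOne_clamp_le (E : DirichletForm m) (b : ℝ) (u : E.domain) :
    E.energyOne (E.clamp b u) ≤ E.energyOne u :=
  (E.exists_clamp b u).choose_spec.2

lemma coeFn_add (E : DirichletForm m) (u v : E.domain) :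
    ∀ᵐ x ∂m, ((u + v : E.domain) : Lp ℝ 2 m) x = (u : Lp ℝ 2 m) x + (v : Lp ℝ 2 m) x :=
  Lp.coeFn_add (u : Lp ℝ 2 m) v

lemma coeFn_sub (E : DirichletForm m) (u v : E.domain) :
    ∀ᵐ x ∂m, ((u - v : E.domain) : Lp ℝ 2 m) x = (u : Lp ℝ 2 m) x - (v : Lp ℝ 2 m) x :=
  Lp.coeFn_sub (u : Lp ℝ 2 m) v

lemma coeFn_neg (E : DirichletForm m) (u : E.domain) :
    ∀ᵐ x ∂m, ((-u : E.domain) : Lp ℝ 2 m) x = -(u : Lp ℝ 2 m) x :=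
  Lp.coeFn_neg (u : Lp ℝ 2 m)

lemma coeFn_smul (E : DirichletForm m) (a : ℝ) (u : E.domain) :
    ∀ᵐ x ∂m, ((a • u : E.domain) : Lp ℝ 2 m) x = a * (u : Lp ℝ 2 m) x :=
  Lp.coeFn_smul a (u : Lp ℝ 2 m)

end Truncation

/-! ### Sets of small capacity and the scalar flattening function -/

section Capacity

variable {X : Type*} [TopologicalSpace X] [MeasurableSpace X] {m : Measure X}

lemma exists_potential_of_capacity_lt (E : DirichletForm m) {A : Set X} {η : ℝ≥0∞}
    (hA : E.capacity A < η) :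
    ∃ (G : Set X) (e : E.domain), IsOpen G ∧ A ⊆ G ∧
      (∀ᵐ x ∂m, 0 ≤ (e : Lp ℝ 2 m) x ∧ (e : Lp ℝ 2 m) x ≤ 1) ∧
      (∀ᵐ x ∂m, x ∈ G → (e : Lp ℝ 2 m) x = 1) ∧ ENNReal.ofReal (E.energyOne e) < η := by
  simp only [capacity, iInf_lt_iff] at hA
  obtain ⟨G, hG, hAG, hlt⟩ := hA
  simp only [openCapacity, iInf_lt_iff] at hlt
  obtain ⟨u, hu, hlt⟩ := hlt
  refine ⟨G, E.clamp 1 u, hG, hAG, ?_, ?_, ?_⟩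
  · filter_upwards [E.coeFn_clamp zero_le_one u] with x hx
    rw [hx]
    exact ⟨le_min zero_le_one (le_max_right _ _), min_le_left _ _⟩
  · filter_upwards [E.coeFn_clamp zero_le_one u, hu] with x hx hux hxG
    rw [hx, min_eq_left]
    exact (hux hxG).trans (le_max_left _ _)
  · exact (ENNReal.ofReal_le_ofReal (E.energyOne_clamp_le 1 u)).trans_lt hlt

lemma exists_isOpen_superset_capacity_lt (E : DirichletForm m) {A : Set X} {η : ℝ≥0∞}
    (hA : E.capacity A < η) : ∃ G, IsOpen G ∧ A ⊆ G ∧ E.capacity G < η := by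
  simp only [capacity, iInf_lt_iff] at hA
  obtain ⟨G, hG, hAG, hlt⟩ := hA
  have hle : E.capacity G ≤ E.openCapacity G :=
    iInf_le_of_le G (iInf_le_of_le hG (iInf_le _ subset_rfl))
  exact ⟨G, hG, hAG, hle.trans_lt hlt⟩

/-- A weak form of the subadditivity of the capacity, which is all that is needed to unite finitely
many small exceptional sets. -/
lemma capacity_union_lt (E : DirichletForm m) {A B : Set X} {η : ℝ≥0∞}
    (hA : E.capacity A < η) (hB : E.capacity B < η) : E.capacity (A ∪ B) < 4 * η := by
  obtain ⟨G, e, hG, hAG, he, heG, hlt⟩ := E.exists_potential_of_capacity_lt hA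
  obtain ⟨G', e', hG', hBG', he', heG', hlt'⟩ := E.exists_potential_of_capacity_lt hB
  have hle : E.capacity (A ∪ B) ≤ ENNReal.ofReal (E.energyOne (e + e')) := by
    refine iInf_le_of_le (G ∪ G') (iInf_le_of_le (hG.union hG')
      (iInf_le_of_le (union_subset_union hAG hBG') (iInf_le_of_le (e + e') (iInf_le _ ?_))))
    filter_upwards [E.coeFn_add e e', he, he', heG, heG'] with x hx h1 h2 h3 h4 hxG
    rw [hx]
    rcases hxG with h | h
    · linarith [h3 h]
    · linarith [h4 h]
  refine hle.trans_lt ?_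
  have h2 : ENNReal.ofReal (E.energyOne (e + e'))
      ≤ 2 * ENNReal.ofReal (E.energyOne e) + 2 * ENNReal.ofReal (E.energyOne e') := by
    refine (ENNReal.ofReal_le_ofReal (E.energyOne_add_le e e')).trans ?_
    rw [ENNReal.ofReal_add (by linarith [E.energyOne_nonneg e])
      (by linarith [E.energyOne_nonneg e']), ENNReal.ofReal_mul zero_le_two,
      ENNReal.ofReal_mul zero_le_two, ENNReal.ofReal_ofNat]
  refine h2.trans_lt ?_
  have e4 : 4 * η = 2 * η + 2 * η := by ring
  rw [e4]
  exact ENNReal.add_lt_add (ENNReal.mul_lt_mul_right (by norm_num) (by norm_num) hlt)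
    (ENNReal.mul_lt_mul_right (by norm_num) (by norm_num) hlt')

/-- Two quasi-continuous functions are continuous off a common open set of small capacity. -/
lemma QuasiContinuous.exists_common {E : DirichletForm m} {g h : X → ℝ}
    (hg : E.QuasiContinuous g) (hh : E.QuasiContinuous h) {η : ℝ≥0∞} (hη : 0 < η) :
    ∃ G : Set X, IsOpen G ∧ E.capacity G < η ∧ ContinuousOn g Gᶜ ∧ ContinuousOn h Gᶜ := by
  have hη4 : 0 < η / 4 := ENNReal.div_pos hη.ne' (by norm_num)
  obtain ⟨G, hG, hGη, hgG⟩ := hg _ hη4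
  obtain ⟨H, hH, hHη, hhH⟩ := hh _ hη4
  refine ⟨G ∪ H, hG.union hH, ?_, hgG.mono (compl_subset_compl.2 subset_union_left),
    hhH.mono (compl_subset_compl.2 subset_union_right)⟩
  have := E.capacity_union_lt hGη hHη
  rwa [ENNReal.mul_div_cancel (by norm_num) (by norm_num)] at this

/-- The scalar function behind the flattening procedure, for `c ≥ 0`. At `s = 0` it approximates `t`
as `ε` tends to `0` and `M` to infinity; it takes the constant value `max 0 (c - ε)` for `t` within
distance `ε` of `c`, and for every `t` if `s = 1`. The three summands stand for the part of `t`
in `[0, c]`, the part above `c` and the negative part. -/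
noncomputable def flatten (c ε M s t : ℝ) : ℝ :=
  min (max 0 (c - ε)) (max (min c (max t 0) + c * s) 0)
    + min M (max (min M (max t 0) - min (c + ε) (max t 0) - M * s) 0)
    - min M (max (min M (max (-t) 0) - min ε (max (-t) 0) - M * s) 0)

lemma flatten_eq {c ε M s t : ℝ} (hc : 0 ≤ c) (hε : 0 < ε) (hM : 0 < M) (hs : 0 ≤ s)
    (h : s = 1 ∨ |t - c| ≤ ε) : flatten c ε M s t = max 0 (c - ε) := by
  have hMs : 0 ≤ M * s := mul_nonneg hM.le hs
  have hcs : 0 ≤ c * s := mul_nonneg hc hs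
  unfold flatten
  rcases h with rfl | h
  · grind
  · rw [abs_le] at h
    generalize M * s = p at *
    generalize c * s = q at *
    grind

lemma abs_flatten_le {c ε M s t : ℝ} (hc : 0 ≤ c) (hε : 0 < ε) (hM : 0 < M) :
    |flatten c ε M s t| ≤ c + 2 * M := by
  unfold flatten
  generalize M * s = p at *
  generalize c * s = q at *
  rw [abs_le]
  constructor <;> grind

lemma abs_flatten_sub_le {c ε M s t : ℝ} (hc : 0 ≤ c) (hM : 0 < M) (hs : 0 ≤ s) :
    |flatten c ε M s t - flatten c ε M 0 t| ≤ (c + 2 * M) * s := by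
  have hlip : ∀ b p q : ℝ, |min b (max p 0) - min b (max q 0)| ≤ |p - q| := fun b p q =>
    (abs_min_sub_min_le_max _ _ _ _).trans (by
      rw [sub_self, abs_zero]
      exact max_le (abs_nonneg _) ((abs_max_sub_max_le_max _ _ _ _).trans (by simp)))
  have hMs : 0 ≤ M * s := mul_nonneg hM.le hs
  have hcs : 0 ≤ c * s := mul_nonneg hc hs
  unfold flatten
  have h1 := hlip (max 0 (c - ε)) (min c (max t 0) + c * s) (min c (max t 0) + c * 0)
  have h2 := hlip M (min M (max t 0) - min (c + ε) (max t 0) - M * s)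
    (min M (max t 0) - min (c + ε) (max t 0) - M * 0)
  have h3 := hlip M (min M (max (-t) 0) - min ε (max (-t) 0) - M * s)
    (min M (max (-t) 0) - min ε (max (-t) 0) - M * 0)
  have e1 : |min c (max t 0) + c * s - (min c (max t 0) + c * 0)| = c * s := by
    rw [← abs_of_nonneg hcs]; congr 1; ring_nf; rw [abs_of_nonneg (by linarith)]
  have e2 : ∀ p : ℝ, |p - M * s - (p - M * 0)| = M * s := fun p => by
    rw [show p - M * s - (p - M * 0) = -(M * s) by ring, abs_neg, abs_of_nonneg hMs]
  rw [e1] at h1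
  rw [e2] at h2 h3
  rw [abs_le] at *
  constructor <;> linarith [h1.1, h1.2, h2.1, h2.2, h3.1, h3.2]

lemma abs_flatten_zero_le {c ε M t : ℝ} (hc : 0 ≤ c) (hε : 0 < ε) (hM : 0 < M) :
    |flatten c ε M 0 t| ≤ 3 * |t| := by
  unfold flatten
  simp only [mul_zero, add_zero, sub_zero]
  rcases abs_cases t with ⟨h, h'⟩ | ⟨h, h'⟩ <;> rw [h, abs_le] <;> constructor <;> grind

lemma abs_flatten_zero_sub_le {c ε M t : ℝ} (hc : 0 ≤ c) (hε : 0 < ε) (hM : 0 < M)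
    (htM : |t| ≤ M) : |flatten c ε M 0 t - t| ≤ 2 * ε := by
  unfold flatten
  simp only [mul_zero, add_zero, sub_zero]
  rw [abs_le] at htM ⊢
  constructor <;> grind

end Capacity

/-! ### The flattening principle -/

section Flat

variable {X : Type*} [MeasurableSpace X] {m : Measure X}

/-- The element of the domain given by `flatten c ε M e u`, for a potential `e` with values in
`[0, 1]`. -/
noncomputable def flat (E : DirichletForm m) (c ε M : ℝ) (e u : E.domain) : E.domain :=
  E.clamp (max 0 (c - ε)) (E.clamp c u + c • e)
    + E.clamp M (E.clamp M u - E.clamp (c + ε) u - M • e)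
    - E.clamp M (E.clamp M (-u) - E.clamp ε (-u) - M • e)

lemma coeFn_flat (E : DirichletForm m) {c ε M : ℝ} (hc : 0 ≤ c) (hε : 0 < ε) (hM : 0 < M)
    (e u : E.domain) : ∀ᵐ x ∂m, (E.flat c ε M e u : Lp ℝ 2 m) x
      = flatten c ε M ((e : Lp ℝ 2 m) x) ((u : Lp ℝ 2 m) x) := by
  filter_upwards [
    E.coeFn_sub (E.clamp (max 0 (c - ε)) (E.clamp c u + c • e)
      + E.clamp M (E.clamp M u - E.clamp (c + ε) u - M • e))
      (E.clamp M (E.clamp M (-u) - E.clamp ε (-u) - M • e)),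
    E.coeFn_add (E.clamp (max 0 (c - ε)) (E.clamp c u + c • e))
      (E.clamp M (E.clamp M u - E.clamp (c + ε) u - M • e)),
    E.coeFn_clamp (le_max_left 0 (c - ε)) (E.clamp c u + c • e),
    E.coeFn_clamp hM.le (E.clamp M u - E.clamp (c + ε) u - M • e),
    E.coeFn_clamp hM.le (E.clamp M (-u) - E.clamp ε (-u) - M • e),
    E.coeFn_add (E.clamp c u) (c • e),
    E.coeFn_sub (E.clamp M u - E.clamp (c + ε) u) (M • e),
    E.coeFn_sub (E.clamp M (-u) - E.clamp ε (-u)) (M • e),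
    E.coeFn_sub (E.clamp M u) (E.clamp (c + ε) u),
    E.coeFn_sub (E.clamp M (-u)) (E.clamp ε (-u)),
    E.coeFn_clamp hc u, E.coeFn_clamp hM.le u, E.coeFn_clamp (add_nonneg hc hε.le) u,
    E.coeFn_clamp hM.le (-u), E.coeFn_clamp hε.le (-u), E.coeFn_neg u,
    E.coeFn_smul c e, E.coeFn_smul M e]
    with x h1 h2 h3 h4 h5 h6 h7 h8 h9 h10 h11 h12 h13 h14 h15 h16 h17 h18
  rw [flat, h1, h2, h3, h4, h5, h6, h7, h8, h9, h10, h11, h12, h13, h14, h15, h16, h17, h18,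
    flatten]

lemma energyOne_flat_le (E : DirichletForm m) {c ε M : ℝ} {e u : E.domain}
    (hce : c ^ 2 * E.energyOne e ≤ 1) (hMe : M ^ 2 * E.energyOne e ≤ 1) :
    E.energyOne (E.flat c ε M e u) ≤ 56 * E.energyOne u + 20 := by
  have hc' := E.energyOne_smul c e
  have hM' := E.energyOne_smul M e
  have ha : E.energyOne (E.clamp (max 0 (c - ε)) (E.clamp c u + c • e))
      ≤ 2 * E.energyOne u + 2 := by
    refine (E.energyOne_clamp_le _ _).trans ((E.energyOne_add_le _ _).trans ?_)
    linarith [E.energyOne_clamp_le c u]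
  have hb : ∀ (a : ℝ) (w : E.domain),
      E.energyOne (E.clamp M (E.clamp M w - E.clamp a w - M • e)) ≤ 8 * E.energyOne w + 2 := by
    intro a w
    refine (E.energyOne_clamp_le _ _).trans ((E.energyOne_sub_le _ _).trans ?_)
    linarith [E.energyOne_sub_le (E.clamp M w) (E.clamp a w), E.energyOne_clamp_le M w,
      E.energyOne_clamp_le a w]
  have h1 := hb (c + ε) u
  have h2 := hb ε (-u)
  rw [E.energyOne_neg] at h2
  refine (E.energyOne_sub_le _ _).trans ?_
  linarith [E.energyOne_add_le (E.clamp (max 0 (c - ε)) (E.clamp c u + c • e))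
    (E.clamp M (E.clamp M u - E.clamp (c + ε) u - M • e))]

lemma tendsto_flat_zero (E : DirichletForm m) {c : ℝ} (hc : 0 ≤ c) {ε M : ℕ → ℝ}
    (hε : ∀ n, 0 < ε n) (hM : ∀ n, 0 < M n) (hε0 : Tendsto ε atTop (𝓝 0))
    (hMtop : Tendsto M atTop atTop) (u : E.domain) :
    Tendsto (fun n => (E.flat c (ε n) (M n) 0 u : Lp ℝ 2 m)) atTop (𝓝 (u : Lp ℝ 2 m)) := by
  have hz : ∀ᵐ x ∂m, ((0 : E.domain) : Lp ℝ 2 m) x = 0 := Lp.coeFn_zero ℝ 2 m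
  refine Lp.tendsto_two_of_dominated (b := fun x => 3 * |(u : Lp ℝ 2 m) x|) ?_ ?_ ?_
  · exact (Lp.memLp (u : Lp ℝ 2 m)).abs.const_mul 3
  · intro n
    filter_upwards [E.coeFn_flat hc (hε n) (hM n) 0 u, hz] with x h1 h2
    rw [h1, h2]
    exact abs_flatten_zero_le hc (hε n) (hM n)
  · filter_upwards [ae_all_iff.2 fun n => E.coeFn_flat hc (hε n) (hM n) 0 u, hz] with x h1 h2
    rw [tendsto_iff_norm_sub_tendsto_zero]
    refine squeeze_zero' (Eventually.of_forall fun n => norm_nonneg _) (g := fun n => 2 * ε n)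
      ?_ (by simpa using hε0.const_mul 2)
    filter_upwards [hMtop.eventually_ge_atTop |(u : Lp ℝ 2 m) x|] with n hn
    rw [h1 n, h2]
    exact abs_flatten_zero_sub_le hc (hε n) (hM n) hn

lemma norm_flat_sub_flat_zero_le (E : DirichletForm m) {c ε M : ℝ} (hc : 0 ≤ c) (hε : 0 < ε)
    (hM : 0 < M) {e : E.domain} (he : ∀ᵐ x ∂m, 0 ≤ (e : Lp ℝ 2 m) x) (u : E.domain) :
    ‖(E.flat c ε M e u : Lp ℝ 2 m) - E.flat c ε M 0 u‖ ≤ (c + 2 * M) * ‖(e : Lp ℝ 2 m)‖ := by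
  have hz : ∀ᵐ x ∂m, ((0 : E.domain) : Lp ℝ 2 m) x = 0 := Lp.coeFn_zero ℝ 2 m
  refine Lp.norm_le_mul_norm_of_ae_le_mul ?_
  filter_upwards [Lp.coeFn_sub (E.flat c ε M e u : Lp ℝ 2 m) (E.flat c ε M 0 u),
    E.coeFn_flat hc hε hM e u, E.coeFn_flat hc hε hM 0 u, hz, he] with x h1 h2 h3 h4 h5
  rw [h1, Pi.sub_apply, h2, h3, h4, Real.norm_eq_abs, Real.norm_eq_abs, abs_of_nonneg h5]
  exact abs_flatten_sub_le hc hM h5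

end Flat

section Density

variable {X : Type*} [TopologicalSpace X] [MeasurableSpace X] {m : Measure X}

/-- Flattening principle: every element `u` of the domain is an energy limit, up to convex
combinations, of bounded elements which are constant near the level `c` of `u` and also on a set of
arbitrarily small capacity. Consequently a convex set `S` which contains the elements of this kind
has `u` in its closure. For `c = 0` the constant is `0`. -/
theorem exists_mem_energyOne_sub_lt_of_flat (E : DirichletForm m) {c : ℝ} (hc : 0 ≤ c)
    (u : E.domain) {S : Set E.domain} (hS : Convex ℝ S)
    (h : ∀ ε : ℝ, 0 < ε → ∀ η : ℝ≥0∞, 0 < η → ∃ A : Set X, E.capacity A < η ∧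
      ∀ v : E.domain, (∃ M : ℝ, ∀ᵐ x ∂m, |(v : Lp ℝ 2 m) x| ≤ M) →
        (∀ᵐ x ∂m, x ∈ A ∨ |(u : Lp ℝ 2 m) x - c| ≤ ε → (v : Lp ℝ 2 m) x = max 0 (c - ε)) →
        v ∈ S)
    {ε : ℝ} (hε : 0 < ε) : ∃ s ∈ S, E.energyOne (s - u) < ε := by
  let δ : ℕ → ℝ := fun n => 1 / ((n : ℝ) + 1)
  let M : ℕ → ℝ := fun n => c + (n + 1)
  have hδ : ∀ n, 0 < δ n := fun n => by positivity
  have hδ1 : ∀ n, δ n ≤ 1 := fun n => by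
    rw [div_le_one (by positivity)]
    linarith [n.cast_nonneg (α := ℝ)]
  have hM : ∀ n, 0 < M n := fun n => by positivity
  have hcM : ∀ n, c ≤ M n := fun n => by simp only [M]; linarith [n.cast_nonneg (α := ℝ)]
  have hδ0 : Tendsto δ atTop (𝓝 0) := tendsto_one_div_add_atTop_nhds_zero_nat
  have hMtop : Tendsto M atTop atTop :=
    tendsto_atTop_add_const_left _ _
      (tendsto_atTop_add_const_right _ _ tendsto_natCast_atTop_atTop)
  -- The potentials must beat the factors `c` and `M n` in front of them.
  have hex : ∀ n, ∃ (A : Set X) (e : E.domain),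
      (∀ v : E.domain, (∃ M : ℝ, ∀ᵐ x ∂m, |(v : Lp ℝ 2 m) x| ≤ M) →
        (∀ᵐ x ∂m, x ∈ A ∨ |(u : Lp ℝ 2 m) x - c| ≤ δ n →
          (v : Lp ℝ 2 m) x = max 0 (c - δ n)) → v ∈ S) ∧
      (∀ᵐ x ∂m, 0 ≤ (e : Lp ℝ 2 m) x) ∧ (∀ᵐ x ∂m, x ∈ A → (e : Lp ℝ 2 m) x = 1) ∧
      M n ^ 2 * E.energyOne e ≤ δ n := fun n => by
    have hpos : 0 < δ n / M n ^ 2 := div_pos (hδ n) (pow_pos (hM n) 2)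
    obtain ⟨A, hA, hAS⟩ := h (δ n) (hδ n) (ENNReal.ofReal (δ n / M n ^ 2))
      (ENNReal.ofReal_pos.2 hpos)
    obtain ⟨G, e, -, hAG, he, heG, hlt⟩ := E.exists_potential_of_capacity_lt hA
    refine ⟨A, e, hAS, he.mono fun x hx => hx.1, heG.mono fun x hx hxA => hx (hAG hxA), ?_⟩
    have := (ENNReal.ofReal_lt_ofReal_iff hpos).1 hlt
    rw [lt_div_iff₀ (pow_pos (hM n) 2)] at this
    linarith
  choose A e hAS he heA heM using hex
  have hce : ∀ n, c ^ 2 * E.energyOne (e n) ≤ 1 := fun n =>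
    ((mul_le_mul_of_nonneg_right (pow_le_pow_left₀ hc (hcM n) 2) (E.energyOne_nonneg _)).trans
      (heM n)).trans (hδ1 n)
  have hlim : Tendsto (fun n => (E.flat c (δ n) (M n) (e n) u : Lp ℝ 2 m)) atTop
      (𝓝 (u : Lp ℝ 2 m)) := by
    have h0 : Tendsto (fun n => (E.flat c (δ n) (M n) (e n) u : Lp ℝ 2 m)
        - E.flat c (δ n) (M n) 0 u) atTop (𝓝 0) := by
      rw [tendsto_zero_iff_norm_tendsto_zero]
      refine squeeze_zero (fun n => norm_nonneg _) (g := fun n => 3 * Real.sqrt (δ n)) ?_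
        (by simpa using hδ0.sqrt.const_mul 3)
      intro n
      refine (E.norm_flat_sub_flat_zero_le hc (hδ n) (hM n) (he n) u).trans ?_
      have h1 : M n * ‖(e n : Lp ℝ 2 m)‖ ≤ Real.sqrt (δ n) := by
        refine Real.le_sqrt_of_sq_le ?_
        rw [mul_pow]
        exact (mul_le_mul_of_nonneg_left (E.norm_sq_le_energyOne (e n)) (sq_nonneg _)).trans
          (heM n)
      have h2 := mul_le_mul_of_nonneg_right (hcM n) (norm_nonneg (e n : Lp ℝ 2 m))
      linarith
    simpa using h0.add (E.tendsto_flat_zero hc hδ hM hδ0 hMtop u)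
  have hmem : ∀ n, E.flat c (δ n) (M n) (e n) u ∈ S := fun n => by
    refine hAS n _ ⟨c + 2 * M n, ?_⟩ ?_
    · filter_upwards [E.coeFn_flat hc (hδ n) (hM n) (e n) u] with x hx
      rw [hx]
      exact abs_flatten_le hc (hδ n) (hM n)
    · filter_upwards [E.coeFn_flat hc (hδ n) (hM n) (e n) u, he n, heA n] with x h1 h2 h3 h4
      rw [h1]
      exact flatten_eq hc (hδ n) (hM n) h2 (h4.imp_left h3)
  obtain ⟨v, hv, hvS⟩ := E.exists_domain_eq_of_tendsto hS hmem
    (fun n => E.energyOne_flat_le (hce n) ((heM n).trans (hδ1 n))) hlim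
  obtain rfl : v = u := Subtype.ext hv
  exact hvS ε hε

end Density

/-! ### The equation off the coincidence set -/

section Obstacle

/-- A continuous function without zeros on a compact set is bounded away from `0` there. -/
lemma _root_.IsCompact.exists_pos_forall_le_abs {X : Type*} [TopologicalSpace X] {K : Set X} (hK : IsCompact K) {g : X → ℝ}
    (hg : ContinuousOn g K) (h0 : ∀ x ∈ K, g x ≠ 0) : ∃ δ : ℝ, 0 < δ ∧ ∀ x ∈ K, δ ≤ |g x| := by
  rcases K.eq_empty_or_nonempty with rfl | hne
  · exact ⟨1, one_pos, by simp⟩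
  · obtain ⟨x, hx, hmin⟩ := hK.exists_isMinOn hne hg.abs
    exact ⟨|g x|, abs_pos.2 (h0 x hx), hmin⟩

variable {X : Type*} [MeasurableSpace X] {m : Measure X}

lemma form_sq_le (E : DirichletForm m) (u v : E.domain) :
    E.form u v ^ 2 ≤ E.form u u * E.form v v := by
  have := LinearMap.BilinForm.apply_mul_apply_le_of_forall_zero_le E.form E.nonneg u v
  rwa [E.symm v u, ← sq] at this

/-- A functional which is bounded for the energy norm vanishes at the points which are energy limits
of its zeros. -/
lemma eq_zero_of_forall_exists (E : DirichletForm m) {F : E.domain →ₗ[ℝ] ℝ}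
    (hF : E.IsBoundedFunctional F) {u : E.domain}
    (h : ∀ ε : ℝ, 0 < ε → ∃ s ∈ {s | F s = 0}, E.energyOne (s - u) < ε) : F u = 0 := by
  obtain ⟨C, hC⟩ := hF
  by_contra hne
  have hpos : 0 < |F u| := abs_pos.2 hne
  have hD : 0 < |C| + 1 := by positivity
  obtain ⟨s, hs, hlt⟩ := h ((|F u| / (|C| + 1)) ^ 2) (by positivity)
  have h1 := hC (s - u)
  rw [map_sub, show F s = 0 from hs, zero_sub, abs_neg] at h1
  have h2 : Real.sqrt (E.energyOne (s - u)) < |F u| / (|C| + 1) := by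
    rwa [Real.sqrt_lt' (by positivity)]
  rw [lt_div_iff₀ hD] at h2
  have h3 := mul_le_mul_of_nonneg_right (le_abs_self C) (Real.sqrt_nonneg (E.energyOne (s - u)))
  linarith [Real.sqrt_nonneg (E.energyOne (s - u))]

lemma isBoundedFunctional_gen_sub (E : DirichletForm m) (u : E.domain) {f : E.domain →ₗ[ℝ] ℝ}
    (hf : E.IsBoundedFunctional f) : E.IsBoundedFunctional (E.gen u - f) := by
  obtain ⟨C, hC⟩ := hf
  refine ⟨Real.sqrt (E.form u u) + C, fun v => ?_⟩
  have h1 : |E.form u v| ≤ Real.sqrt (E.form u u) * Real.sqrt (E.energyOne v) := by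
    rw [← Real.sqrt_mul (E.nonneg u)]
    refine Real.abs_le_sqrt ((E.form_sq_le u v).trans ?_)
    refine mul_le_mul_of_nonneg_left ?_ (E.nonneg u)
    exact le_add_of_nonneg_right real_inner_self_nonneg
  rw [LinearMap.sub_apply, gen, add_mul]
  exact (abs_sub _ _).trans (add_le_add h1 (hC v))

variable [TopologicalSpace X]

/-- If, off sets of small capacity, the obstacle stays uniformly below the solution `u` wherever `ζ`
is not small, then `ζ` is a limit of directions in which `u` may be varied both ways, so that the
variational inequality is an equation for `ζ`. -/
lemma IsObstacleSolution.form_eq {E : DirichletForm m} {ψ : X → ℝ} {f : E.domain →ₗ[ℝ] ℝ}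
    {u : E.domain} (hu : E.IsObstacleSolution ψ f u) (hf : E.IsBoundedFunctional f)
    (ζ : E.domain)
    (h : ∀ ε : ℝ, 0 < ε → ∀ η : ℝ≥0∞, 0 < η → ∃ (A : Set X) (δ : ℝ), 0 < δ ∧ E.capacity A < η ∧
      ∀ᵐ x ∂m, x ∉ A → ε < |(ζ : Lp ℝ 2 m) x| → ψ x + δ ≤ (u : Lp ℝ 2 m) x) :
    E.gen u ζ = f ζ := by
  have key : (E.gen u - f) ζ = 0 := by
    refine E.eq_zero_of_forall_exists (E.isBoundedFunctional_gen_sub u hf) fun ε hε =>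
      E.exists_mem_energyOne_sub_lt_of_flat le_rfl ζ (E.gen u - f).ker.convex ?_ hε
    intro ε hε η hη
    obtain ⟨A, δ, hδ, hA, hAδ⟩ := h ε hε η hη
    refine ⟨A, hA, fun v ⟨M, hM⟩ hv => ?_⟩
    have hadm : ∀ t : ℝ, |t| * M ≤ δ → f (t • v) ≤ E.form u (t • v) := by
      intro t ht
      have hmem : u + t • v ∈ E.obstacleSet ψ := by
        have hψu : ∀ᵐ x ∂m, ψ x ≤ (u : Lp ℝ 2 m) x := hu.1
        filter_upwards [hψu, E.coeFn_add u (t • v), E.coeFn_smul t v, hM, hv, hAδ]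
          with x h1 h2 h3 h4 h5 h6
        rw [h2, h3]
        by_cases hx : x ∈ A ∨ |(ζ : Lp ℝ 2 m) x - 0| ≤ ε
        · rw [h5 hx, zero_sub, max_eq_left (by linarith)]
          linarith
        · rw [not_or, sub_zero, not_le] at hx
          have h7 : |t * (v : Lp ℝ 2 m) x| ≤ δ := by
            rw [abs_mul]
            exact (mul_le_mul_of_nonneg_left h4 (abs_nonneg t)).trans ht
          linarith [h6 hx.1 hx.2, (abs_le.1 h7).1]
      simpa using hu.2 _ hmem
    have hM0 : 0 < |M| + 1 := by positivity
    have htpos : 0 < δ / (|M| + 1) := div_pos hδ hM0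
    have ht : δ / (|M| + 1) * M ≤ δ := by
      rw [div_mul_eq_mul_div, div_le_iff₀ hM0]
      exact mul_le_mul_of_nonneg_left ((le_abs_self M).trans (by linarith)) hδ.le
    have h1 := hadm (δ / (|M| + 1)) (by rwa [abs_of_pos htpos])
    have h2 := hadm (-(δ / (|M| + 1))) (by rwa [abs_neg, abs_of_pos htpos])
    simp only [map_smul, smul_eq_mul, neg_mul, neg_le_neg_iff] at h1 h2
    have h3 : E.form u v = f v := mul_left_cancel₀ htpos.ne' (le_antisymm h2 h1)
    change (E.gen u - f) v = 0
    rw [LinearMap.sub_apply, gen, h3, sub_self]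
  exact sub_eq_zero.1 key

variable {E : DirichletForm m} {ψ : X → ℝ} {f : E.domain →ₗ[ℝ] ℝ} {u : E.domain} {ut : X → ℝ}

lemma IsObstacleSolution.eqOffSet [T2Space X] (hu : E.IsObstacleSolution ψ f u)
    (hf : E.IsBoundedFunctional f) (hψ : E.QuasiContinuous ψ)
    (hut : E.IsQuasiContinuousVersion ut u) : E.EqOffSet (E.gen u) f {x | ut x = ψ x} := by
  rintro ζ ⟨K, hK, hdisj, hζK⟩
  refine hu.form_eq hf ζ fun ε hε η hη => ?_
  obtain ⟨G, hG, hGη, hutG, hψG⟩ := hut.1.exists_common hψ hη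
  obtain ⟨δ, hδ, hKδ⟩ := (hK.diff hG).exists_pos_forall_le_abs (g := fun x => ut x - ψ x)
    ((hutG.sub hψG).mono fun x hx => hx.2)
    fun x hx h => disjoint_left.1 hdisj hx.1 (sub_eq_zero.1 h)
  refine ⟨G, δ, hδ, hGη, ?_⟩
  have hψu : ∀ᵐ x ∂m, ψ x ≤ (u : Lp ℝ 2 m) x := hu.1
  filter_upwards [hψu, hut.2, hζK] with x h1 h2 h3 hxG hxζ
  have hxK : x ∈ K := by
    by_contra hxK
    rw [h3 hxK, abs_zero] at hxζ
    linarith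
  have h4 := hKδ x ⟨hxK, hxG⟩
  rw [abs_of_nonneg (by linarith)] at h4
  linarith

lemma IsObstacleSolution.quasiEqOffSet [T2Space X] (hu : E.IsObstacleSolution ψ f u)
    (hf : E.IsBoundedFunctional f) (hψ : E.QuasiContinuous ψ)
    (hut : E.IsQuasiContinuousVersion ut u) : E.QuasiEqOffSet (E.gen u) f {x | ut x = ψ x} := by
  rintro ζ ⟨K, hK, hζK⟩ ⟨z, ⟨hzc, hzζ⟩, hz0⟩
  refine hu.form_eq hf ζ fun ε hε η hη => ?_
  have hη16 : 0 < η / 4 / 4 :=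
    ENNReal.div_pos (ENNReal.div_pos hη.ne' (by norm_num)).ne' (by norm_num)
  have hη4 : 0 < η / 4 := ENNReal.div_pos hη.ne' (by norm_num)
  obtain ⟨G, hG, hGη, hutG, hψG⟩ := hut.1.exists_common hψ hη4
  obtain ⟨H, hH, hHη, hzH⟩ := hzc _ hη16
  obtain ⟨N, hN, hIN, hNη⟩ := E.exists_isOpen_superset_capacity_lt (hz0 ▸ hη16)
  have hHN := E.capacity_union_lt hHη hNη
  rw [ENNReal.mul_div_cancel (by norm_num) (by norm_num)] at hHN
  have hcap := E.capacity_union_lt hGη hHN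
  rw [ENNReal.mul_div_cancel (by norm_num) (by norm_num)] at hcap
  have hA : IsOpen (G ∪ (H ∪ N)) := hG.union (hH.union hN)
  -- On this compact set `z` is not `0`, so that it does not meet the coincidence set.
  have hL : IsCompact ((K \ (G ∪ (H ∪ N))) ∩ z ⁻¹' {r | ε ≤ |r|}) := by
    refine (hK.diff hA).of_isClosed_subset ?_ inter_subset_left
    refine ContinuousOn.preimage_isClosed_of_isClosed ?_ (hK.diff hA).isClosed
      (isClosed_le continuous_const continuous_abs)
    exact hzH.mono fun x hx h => hx.2 (Or.inr (Or.inl h))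
  obtain ⟨δ, hδ, hLδ⟩ := hL.exists_pos_forall_le_abs (g := fun x => ut x - ψ x)
    ((hutG.sub hψG).mono fun x hx h => hx.1.2 (Or.inl h)) (by
      intro x hx h
      refine hx.1.2 (Or.inr (Or.inr (hIN ⟨sub_eq_zero.1 h, fun hzx => ?_⟩)))
      have : ε ≤ |z x| := hx.2
      rw [hzx, abs_zero] at this
      linarith)
  refine ⟨_, δ, hδ, hcap, ?_⟩
  have hψu : ∀ᵐ x ∂m, ψ x ≤ (u : Lp ℝ 2 m) x := hu.1
  filter_upwards [hψu, hut.2, hζK, hzζ] with x h1 h2 h3 h5 hxG hxζ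
  have hxK : x ∈ K := by
    by_contra hxK
    rw [h3 hxK, abs_zero] at hxζ
    linarith
  have h4 := hLδ x ⟨⟨hxK, hxG⟩, show ε ≤ |z x| from h5 ▸ hxζ.le⟩
  rw [abs_of_nonneg (by linarith)] at h4
  linarith

end Obstacle

/-! ### Squares of bounded elements of the domain -/

section Square

variable {X : Type*} [MeasurableSpace X] {m : Measure X}

lemma coeFn_sum (E : DirichletForm m) {ι : Type*} (s : Finset ι) (y : ι → E.domain) :
    ∀ᵐ x ∂m, ((∑ i ∈ s, y i : E.domain) : Lp ℝ 2 m) x = ∑ i ∈ s, (y i : Lp ℝ 2 m) x := by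
  classical
  induction s using Finset.induction_on with
  | empty =>
    filter_upwards [Lp.coeFn_zero ℝ 2 m] with x hx
    exact hx
  | insert i s hi ih =>
    filter_upwards [ih, E.coeFn_add (y i) (∑ i ∈ s, y i)] with x h1 h2
    rw [Finset.sum_insert hi, Finset.sum_insert hi, h2, h1]

/-- The square `t ^ 2 / 2 = ∫ r in 0..1, (t - r)⁺` for `0 ≤ t ≤ 1`, approximated by Riemann sums. -/
lemma abs_riemann_sum_sub_sq_le {t : ℝ} (h0 : 0 ≤ t) (h1 : t ≤ 1) (n : ℕ) :
    |∑ k ∈ Finset.range (n + 1), (1 / ((n : ℝ) + 1)) *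
        (t - min ((k : ℝ) * (1 / ((n : ℝ) + 1))) (max t 0)) - t ^ 2 / 2| ≤ 1 / ((n : ℝ) + 1) := by
  have hh : 0 < 1 / ((n : ℝ) + 1) := by positivity
  have hn : ((n : ℝ) + 1) * (1 / ((n : ℝ) + 1)) = 1 := by field_simp
  generalize 1 / ((n : ℝ) + 1) = h at *
  have hstep : ∀ a : ℝ,
      |h * max a 0 - ((max a 0) ^ 2 / 2 - (max (a - h) 0) ^ 2 / 2)| ≤ h ^ 2 := by
    intro a
    rcases le_total a 0 with ha | ha
    · rw [max_eq_right ha, max_eq_right (by linarith)]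
      simpa using sq_nonneg h
    rcases le_total a h with hah | hah
    · rw [max_eq_left ha, max_eq_right (by linarith), abs_le]
      constructor <;> nlinarith
    · rw [max_eq_left ha, max_eq_left (by linarith), abs_le]
      constructor <;> nlinarith
  let P : ℕ → ℝ := fun k => (max (t - k * h) 0) ^ 2 / 2
  have htel : ∑ k ∈ Finset.range (n + 1), (P k - P (k + 1)) = t ^ 2 / 2 := by
    rw [Finset.sum_range_sub']
    simp only [P]
    push_cast
    rw [hn, zero_mul, sub_zero, max_eq_left h0, max_eq_right (by linarith)]
    ring
  rw [← htel, ← Finset.sum_sub_distrib]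
  refine (Finset.abs_sum_le_sum_abs _ _).trans ?_
  have hterm : ∀ k ∈ Finset.range (n + 1),
      |h * (t - min ((k : ℝ) * h) (max t 0)) - (P k - P (k + 1))| ≤ h ^ 2 := by
    intro k _
    have e1 : t - min ((k : ℝ) * h) (max t 0) = max (t - k * h) 0 := by
      rw [max_eq_left h0]
      grind
    have e2 : t - ((k + 1 : ℕ) : ℝ) * h = t - k * h - h := by push_cast; ring
    simp only [P]
    rw [e1, e2]
    exact hstep _
  refine (Finset.sum_le_sum hterm).trans ?_
  rw [Finset.sum_const, Finset.card_range, nsmul_eq_mul]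
  push_cast
  exact le_of_eq (by rw [sq, ← mul_assoc, hn, one_mul])

lemma exists_half_sq_clamp_one (E : DirichletForm m) (v : E.domain) :
    ∃ z : E.domain, ∀ᵐ x ∂m, (z : Lp ℝ 2 m) x = (min 1 (max ((v : Lp ℝ 2 m) x) 0)) ^ 2 / 2 := by
  let w := E.clamp 1 v
  have hwv := E.coeFn_clamp zero_le_one v
  have hw : ∀ᵐ x ∂m, 0 ≤ (w : Lp ℝ 2 m) x ∧ (w : Lp ℝ 2 m) x ≤ 1 := by
    filter_upwards [hwv] with x hx
    rw [hx]
    exact ⟨le_min zero_le_one (le_max_right _ _), min_le_left _ _⟩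
  let h : ℕ → ℝ := fun n => 1 / ((n : ℝ) + 1)
  have hh : ∀ n, 0 < h n := fun n => by positivity
  let y : ℕ → E.domain := fun n =>
    ∑ k ∈ Finset.range (n + 1), h n • (w - E.clamp ((k : ℝ) * h n) w)
  have hsum : ∀ n, ∑ _k ∈ Finset.range (n + 1), h n = 1 := fun n => by
    rw [Finset.sum_const, Finset.card_range, nsmul_eq_mul]
    push_cast
    simp only [h]
    field_simp
  have hyC : ∀ n, E.energyOne (y n) ≤ 4 * E.energyOne w := by
    intro n
    refine (E.convexOn_energyOne.map_sum_le (fun _ _ => (hh n).le) (hsum n)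
      (fun _ _ => mem_univ _)).trans ?_
    calc ∑ k ∈ Finset.range (n + 1), h n • E.energyOne (w - E.clamp ((k : ℝ) * h n) w)
        ≤ ∑ _k ∈ Finset.range (n + 1), h n * (4 * E.energyOne w) := by
          refine Finset.sum_le_sum fun k _ => mul_le_mul_of_nonneg_left ?_ (hh n).le
          linarith [E.energyOne_sub_le w (E.clamp ((k : ℝ) * h n) w),
            E.energyOne_clamp_le ((k : ℝ) * h n) w]
      _ = 4 * E.energyOne w := by rw [← Finset.sum_mul, hsum, one_mul]
  have hy : ∀ n, ∀ᵐ x ∂m, (y n : Lp ℝ 2 m) x = ∑ k ∈ Finset.range (n + 1),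
      h n * ((w : Lp ℝ 2 m) x - min ((k : ℝ) * h n) (max ((w : Lp ℝ 2 m) x) 0)) := by
    intro n
    have hk : ∀ᵐ x ∂m, ∀ k : ℕ,
        ((h n • (w - E.clamp ((k : ℝ) * h n) w) : E.domain) : Lp ℝ 2 m) x
          = h n * ((w : Lp ℝ 2 m) x - min ((k : ℝ) * h n) (max ((w : Lp ℝ 2 m) x) 0)) := by
      refine ae_all_iff.2 fun k => ?_
      filter_upwards [E.coeFn_smul (h n) (w - E.clamp ((k : ℝ) * h n) w),
        E.coeFn_sub w (E.clamp ((k : ℝ) * h n) w),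
        E.coeFn_clamp (mul_nonneg k.cast_nonneg (hh n).le) w] with x h1 h2 h3
      rw [h1, h2, h3]
    filter_upwards [hk, E.coeFn_sum (Finset.range (n + 1))
      fun k => h n • (w - E.clamp ((k : ℝ) * h n) w)] with x h1 h2
    rw [h2]
    exact Finset.sum_congr rfl fun k _ => h1 k
  have hmem : MemLp (fun x => ((w : Lp ℝ 2 m) x) ^ 2 / 2) 2 m := by
    refine (Lp.memLp (w : Lp ℝ 2 m)).of_le
      ((continuous_id.pow 2).div_const 2 |>.comp_aestronglyMeasurable
        (Lp.aestronglyMeasurable _)) ?_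
    filter_upwards [hw] with x hx
    rw [Real.norm_eq_abs, Real.norm_eq_abs, abs_of_nonneg (by positivity), abs_of_nonneg hx.1]
    nlinarith [hx.1, hx.2]
  have hlim : Tendsto (fun n => (y n : Lp ℝ 2 m)) atTop (𝓝 hmem.toLp) := by
    refine Lp.tendsto_two_of_dominated (Lp.memLp (w : Lp ℝ 2 m)) ?_ ?_
    · intro n
      filter_upwards [hy n, hw] with x h1 h2
      have h3 : ∀ k : ℕ, 0 ≤ (w : Lp ℝ 2 m) x - min ((k : ℝ) * h n) (max ((w : Lp ℝ 2 m) x) 0) ∧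
          (w : Lp ℝ 2 m) x - min ((k : ℝ) * h n) (max ((w : Lp ℝ 2 m) x) 0)
            ≤ (w : Lp ℝ 2 m) x := fun k => by
        have : 0 ≤ (k : ℝ) * h n := mul_nonneg k.cast_nonneg (hh n).le
        rw [max_eq_left h2.1]
        exact ⟨by linarith [min_le_right ((k : ℝ) * h n) ((w : Lp ℝ 2 m) x)],
          by linarith [le_min this h2.1]⟩
      rw [h1, abs_of_nonneg (Finset.sum_nonneg fun k _ => mul_nonneg (hh n).le (h3 k).1)]
      calc _ ≤ ∑ _k ∈ Finset.range (n + 1), h n * (w : Lp ℝ 2 m) x :=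
            Finset.sum_le_sum fun k _ => mul_le_mul_of_nonneg_left (h3 k).2 (hh n).le
        _ = (w : Lp ℝ 2 m) x := by rw [← Finset.sum_mul, hsum, one_mul]
    · filter_upwards [ae_all_iff.2 hy, hw, hmem.coeFn_toLp] with x h1 h2 h3
      rw [h3, tendsto_iff_norm_sub_tendsto_zero]
      refine squeeze_zero (fun n => norm_nonneg _) (g := h) (fun n => ?_)
        tendsto_one_div_add_atTop_nhds_zero_nat
      rw [h1]
      exact abs_riemann_sum_sub_sq_le h2.1 h2.2 n
  obtain ⟨z, hz, -⟩ := E.exists_domain_eq_of_tendsto convex_univ (fun n => mem_univ (y n)) hyC hlim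
  refine ⟨z, ?_⟩
  filter_upwards [hmem.coeFn_toLp, hwv] with x h1 h2
  rw [hz, h1, h2]

lemma exists_sq_of_bounded (E : DirichletForm m) (v : E.domain) {M : ℝ}
    (hM : ∀ᵐ x ∂m, |(v : Lp ℝ 2 m) x| ≤ M) :
    ∃ z : E.domain, ∀ᵐ x ∂m, (z : Lp ℝ 2 m) x = (v : Lp ℝ 2 m) x ^ 2 := by
  have hM' : 0 < |M| + 1 := by positivity
  obtain ⟨z, hz⟩ := E.exists_half_sq_clamp_one ((|M| + 1)⁻¹ • v)
  obtain ⟨z', hz'⟩ := E.exists_half_sq_clamp_one (-((|M| + 1)⁻¹ • v))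
  refine ⟨(2 * (|M| + 1) ^ 2) • (z + z'), ?_⟩
  filter_upwards [hM, hz, hz', E.coeFn_neg ((|M| + 1)⁻¹ • v), E.coeFn_smul (|M| + 1)⁻¹ v,
    E.coeFn_add z z', E.coeFn_smul (2 * (|M| + 1) ^ 2) (z + z')] with x h1 h2 h3 h4 h5 h6 h7
  rw [h7, h6, h2, h3, h4, h5]
  have h8 : |(|M| + 1)⁻¹ * (v : Lp ℝ 2 m) x| ≤ 1 := by
    rw [abs_mul, abs_inv, abs_of_pos hM', inv_mul_le_one₀ hM']
    exact h1.trans ((le_abs_self M).trans (by linarith))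
  have h9 : (v : Lp ℝ 2 m) x = (|M| + 1) * ((|M| + 1)⁻¹ * (v : Lp ℝ 2 m) x) := by
    rw [mul_inv_cancel_left₀ hM'.ne']
  generalize (|M| + 1)⁻¹ * (v : Lp ℝ 2 m) x = r at *
  rw [h9]
  rw [abs_le] at h8
  rcases le_total r 0 with hr | hr
  · rw [max_eq_right hr, max_eq_left (by linarith : 0 ≤ -r), min_eq_right (by linarith : -r ≤ 1),
      min_eq_right zero_le_one]
    ring
  · rw [max_eq_left hr, max_eq_right (by linarith : -r ≤ 0), min_eq_right h8.2,
      min_eq_right zero_le_one]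
    ring

end Square

/-! ### Cut-off functions in the domain -/

section Cutoff

variable {X : Type*} [TopologicalSpace X] [MeasurableSpace X] {m : Measure X}

/-- The two density properties yield continuous cut-off functions of compact support in the domain:
a truncated uniform approximation `g₀` of a topological cut-off function may fail to vanish far
away, where the possibly discontinuous function of the Urysohn property cuts it off. -/
lemma exists_continuous_cutoff [LocallyCompactSpace X] [T2Space X] {E : DirichletForm m}
    (ha2 : E.UrysohnProperty) (ha3 : E.ContinuousCore) {K U : Set X} (hK : IsCompact K)
    (hU : IsOpen U) (hKU : K ⊆ U) :
    ∃ (φ : E.domain) (g : X → ℝ), Continuous g ∧ HasCompactSupport g ∧ tsupport g ⊆ U ∧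
      (∀ᵐ x ∂m, (φ : Lp ℝ 2 m) x = g x) ∧ (∀ x, 0 ≤ g x) ∧ ∀ x ∈ K, g x = 1 := by
  obtain ⟨L, hL, hKL, hLU⟩ := exists_compact_between hK hU hKU
  obtain ⟨L', hL', hLL', -⟩ := exists_compact_between hL isOpen_univ (subset_univ L)
  obtain ⟨k, hk1, hk0, -, hk⟩ := exists_continuous_one_zero_of_isCompact hK
    isOpen_interior.isClosed_compl (disjoint_compl_right_iff_subset.2 hKL)
  obtain ⟨k', hk'1, hk'0, hk'c, hk'⟩ := exists_continuous_one_zero_of_isCompact hL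
    isOpen_interior.isClosed_compl (disjoint_compl_right_iff_subset.2 hLL')
  obtain ⟨χ, hχ1, hχ0⟩ := ha2 L (interior L') hL isOpen_interior
    (hL'.of_isClosed_subset isClosed_closure
      (closure_minimal interior_subset hL'.isClosed)) hLL'
  obtain ⟨v, g₀, hg₀, hvg₀, hg₀k⟩ := ha3.2 (fun x => 3 * k x - 1)
    ((k.continuous.const_mul 3).sub continuous_const) L' hL' 1 one_pos
  have hLsub : L ⊆ L' := hLL'.trans interior_subset
  have hneg : ∀ x ∈ L', x ∉ interior L → g₀ x ≤ 0 := by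
    intro x hx hxL
    have h1 := hg₀k x hx
    have h2 : k x = 0 := hk0 hxL
    rw [h2, abs_lt] at h1
    linarith [h1.2]
  have hsupp : ∀ x ∉ L, min 1 (max (g₀ x) 0) * k' x = 0 := by
    intro x hx
    by_cases hxL' : x ∈ L'
    · rw [max_eq_right (hneg x hxL' fun h => hx (interior_subset h)), min_eq_right zero_le_one,
        zero_mul]
    · have : k' x = 0 := hk'0 fun h => hxL' (interior_subset h)
      rw [this, mul_zero]
  refine ⟨E.clamp 1 v - E.clamp 1 (E.clamp 1 v - E.clamp 1 χ),
    fun x => min 1 (max (g₀ x) 0) * k' x,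
    (continuous_const.min (hg₀.max continuous_const)).mul k'.continuous, hk'c.mul_left, ?_, ?_,
    fun x => mul_nonneg (le_min zero_le_one (le_max_right _ _)) (hk' x).1, ?_⟩
  · refine (closure_minimal ?_ hL.isClosed).trans hLU
    intro x hx
    by_contra hxL
    exact hx (hsupp x hxL)
  · filter_upwards [hχ1, hχ0, hvg₀, E.coeFn_clamp zero_le_one v, E.coeFn_clamp zero_le_one χ,
      E.coeFn_clamp zero_le_one (E.clamp 1 v - E.clamp 1 χ),
      E.coeFn_sub (E.clamp 1 v) (E.clamp 1 χ),
      E.coeFn_sub (E.clamp 1 v) (E.clamp 1 (E.clamp 1 v - E.clamp 1 χ))]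
      with x h1 h2 h3 h4 h5 h6 h7 h8
    rw [h8, h6, h7, h4, h5, h3]
    by_cases hxL : x ∈ L
    · rw [h1 hxL, show k' x = 1 from hk'1 hxL]
      grind
    · rw [hsupp x hxL]
      by_cases hxL' : x ∈ interior L'
      · have := hneg x (interior_subset hxL') fun h => hxL (interior_subset h)
        grind
      · rw [h2 hxL']
        grind
  · intro x hx
    have hxL : x ∈ L := interior_subset (hKL hx)
    have h1 := hg₀k x (hLsub hxL)
    rw [show k x = 1 from hk1 hx, abs_lt] at h1
    have h2 : 1 ≤ g₀ x := by linarith [h1.1]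
    change min 1 (max (g₀ x) 0) * k' x = 1
    rw [show k' x = 1 from hk'1 hxL, max_eq_left (by linarith), min_eq_left h2, mul_one]

lemma supp_subset_tsupport [OpensMeasurableSpace X] (E : DirichletForm m) {φ : E.domain}
    {g : X → ℝ} (h : ∀ᵐ x ∂m, (φ : Lp ℝ 2 m) x = g x) : E.supp φ ⊆ tsupport g := by
  refine Measure.support_subset_of_isClosed (isClosed_tsupport g) ?_
  rw [mem_ae_iff, Measure.restrict_apply (isClosed_tsupport g).measurableSet.compl]
  refine measure_mono_null ?_ (ae_iff.1 h)
  rintro x ⟨hx, hφ⟩ heq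
  exact hφ (heq.trans (image_eq_zero_of_notMem_tsupport hx))

end Cutoff

end DirichletForm

/-! ### Energy measures of level sets -/

/-- A non-negative signed measure is the signed measure of its variation. -/
lemma MeasureTheory.SignedMeasure.exists_eq_toSignedMeasure_variation {X : Type*}
    [MeasurableSpace X] {s : SignedMeasure X} (hs : ∀ B, 0 ≤ s B) :
    ∃ _ : IsFiniteMeasure s.variation, s = s.variation.toSignedMeasure := by
  have h0 : VectorMeasure.restrict 0 univ ≤ VectorMeasure.restrict s univ :=
    VectorMeasure.restrict_le_restrict_of_subset_le _ _ fun B _ _ => hs B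
  obtain ⟨ν, hν, rfl⟩ : ∃ (ν : Measure X) (_ : IsFiniteMeasure ν), s = ν.toSignedMeasure :=
    ⟨_, s.toMeasureOfZeroLE_finite h0 MeasurableSet.univ,
      (s.toMeasureOfZeroLE_toSignedMeasure h0).symm⟩
  refine ⟨by rw [Measure.variation_toSignedMeasure]; exact hν, ?_⟩
  simp only [Measure.variation_toSignedMeasure]

namespace DirichletForm

/-- Evaluation of an energy measure at a fixed set, as a bilinear form on the domain. -/
def evalAt {X : Type*} [MeasurableSpace X] {m : Measure X} {E : DirichletForm m}
    (μ : E.domain →ₗ[ℝ] E.domain →ₗ[ℝ] SignedMeasure X) (B : Set X) :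
    E.domain →ₗ[ℝ] E.domain →ₗ[ℝ] ℝ :=
  μ.compr₂ { toFun := fun s => s B, map_add' := fun _ _ => rfl, map_smul' := fun _ _ => rfl }

namespace IsEnergyMeasure

variable {X : Type*} [TopologicalSpace X] [MeasurableSpace X] {m : Measure X} {E : DirichletForm m}
  {μ : E.domain →ₗ[ℝ] E.domain →ₗ[ℝ] SignedMeasure X}

lemma apply_le_form (hμ : E.IsEnergyMeasure μ) (u : E.domain) {B : Set X} (hB : MeasurableSet B) :
    μ u u B ≤ E.form u u := by
  rw [hμ.total u u, ← union_compl_self B,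
    VectorMeasure.of_union disjoint_compl_right hB hB.compl]
  linarith [hμ.nonneg u Bᶜ]

lemma apply_sq_le (hμ : E.IsEnergyMeasure μ) (u v : E.domain) (B : Set X) :
    (μ u v B) ^ 2 ≤ μ u u B * μ v v B := by
  have h : μ u v B * μ v u B ≤ μ u u B * μ v v B :=
    LinearMap.BilinForm.apply_mul_apply_le_of_forall_zero_le (evalAt μ B)
      (fun w => hμ.nonneg w B) u v
  rwa [hμ.symm v u, ← sq] at h

lemma apply_eq_zero (hμ : E.IsEnergyMeasure μ) {u : E.domain} {B : Set X} (h : μ u u B = 0)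
    (v : E.domain) : μ u v B = 0 := by
  have := hμ.apply_sq_le u v B
  rw [h, zero_mul] at this
  exact pow_eq_zero_iff two_ne_zero |>.1 (le_antisymm this (sq_nonneg _))

lemma convex_setOf_apply_eq_zero (hμ : E.IsEnergyMeasure μ) (B : Set X) :
    Convex ℝ {s : E.domain | μ s s B = 0} := by
  intro s hs t ht a b _ _ _
  have hs' := hμ.apply_eq_zero hs
  have ht' := hμ.apply_eq_zero ht
  change evalAt μ B (a • s + b • t) (a • s + b • t) = 0
  simp only [map_add, map_smul, LinearMap.add_apply, LinearMap.smul_apply]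
  change a • (a • μ s s B + b • μ t s B) + b • (a • μ s t B + b • μ t t B) = 0
  rw [hs', hs', ht', ht']
  simp

/-- Domination of the energy measure by the energy: null sets of energy measures are stable under
energy limits. -/
lemma apply_eq_zero_of_forall_exists (hμ : E.IsEnergyMeasure μ) {u : E.domain} {B : Set X}
    (hB : MeasurableSet B)
    (h : ∀ ε : ℝ, 0 < ε → ∃ s ∈ {s : E.domain | μ s s B = 0}, E.energyOne (s - u) < ε) :
    μ u u B = 0 := by
  refine le_antisymm (le_of_forall_pos_le_add fun ε hε => ?_) (hμ.nonneg u B)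
  obtain ⟨s, hs, hlt⟩ := h ε hε
  have hs' := hμ.apply_eq_zero hs
  have h1 : evalAt μ B (s - u) (s - u) = μ u u B := by
    simp only [map_sub, LinearMap.sub_apply]
    change μ s s B - μ u s B - (μ s u B - μ u u B) = μ u u B
    rw [hμ.symm u s, hs', hs']
    simp
  have h2 : evalAt μ B (s - u) (s - u) ≤ E.form (s - u) (s - u) := hμ.apply_le_form (s - u) hB
  have h3 : E.form (s - u) (s - u) ≤ E.energyOne (s - u) :=
    le_add_of_nonneg_right real_inner_self_nonneg
  linarith

/-- The energy measure of a bounded element vanishes on open sets on which the element is constant: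
for a cut-off function `φ` supported there, both terms of the formula for `∫ φ dμ[v,v]` vanish by
strong locality. -/
theorem variation_eq_zero_of_ae_eq_const [LocallyCompactSpace X] [T2Space X] [BorelSpace X]
    (hμ : E.IsEnergyMeasure μ) (hloc : E.StronglyLocal) (ha2 : E.UrysohnProperty)
    (ha3 : E.ContinuousCore) {v : E.domain} {M b : ℝ} (hM : ∀ᵐ x ∂m, |(v : Lp ℝ 2 m) x| ≤ M)
    {U : Set X} (hU : IsOpen U) (hb : ∀ᵐ x ∂m, x ∈ U → (v : Lp ℝ 2 m) x = b) :
    (μ v v).variation U = 0 := by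
  by_contra hne
  have hreg := hμ.regular v
  obtain ⟨K, hKU, hK, hpos⟩ := hU.exists_lt_isCompact (pos_iff_ne_zero.2 hne)
  refine hpos.ne' ?_
  obtain ⟨φ, g, hg, hgc, hgU, hφg, hg0, hgK⟩ := exists_continuous_cutoff ha2 ha3 hK hU hKU
  obtain ⟨z, hz⟩ := E.exists_sq_of_bounded v hM
  have hsupp : E.supp φ ⊆ U := (E.supp_subset_tsupport hφg).trans hgU
  have hw : ∀ᵐ x ∂m, ((b • φ : E.domain) : Lp ℝ 2 m) x
      = (v : Lp ℝ 2 m) x * (φ : Lp ℝ 2 m) x := by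
    filter_upwards [E.coeFn_smul b φ, hφg, hb] with x h1 h2 h3
    rw [h1]
    by_cases hx : x ∈ U
    · rw [h3 hx]
    · rw [h2, image_eq_zero_of_notMem_tsupport fun h => hx (hgU h), mul_zero, mul_zero]
  have h1 : E.form v φ = 0 := hloc v φ ⟨b, hb.mono fun x hx hxs => hx (hsupp hxs)⟩
  have h2 : E.form z φ = 0 := hloc z φ ⟨b ^ 2, by
    filter_upwards [hb, hz] with x hx hzx hxs
    rw [hzx, hx (hsupp hxs)]⟩
  have hform := hμ.formula v φ (b • φ) z g ⟨M, hM⟩ hg hgc hφg hw hz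
  rw [h2, map_smul, LinearMap.smul_apply, E.symm φ v, h1, smul_zero, zero_div, sub_zero] at hform
  obtain ⟨hfin, hsm⟩ := SignedMeasure.exists_eq_toSignedMeasure_variation (hμ.nonneg v)
  have hint : ∫ x, g x ∂(μ v v).variation = 0 := by
    rw [← hform]
    conv_rhs => rw [hsm]
    exact VectorMeasure.integral_toSignedMeasure.symm
  rw [integral_eq_zero_iff_of_nonneg hg0 (hg.integrable_of_hasCompactSupport hgc)] at hint
  refine measure_mono_null (fun x hx => ?_) (ae_iff.1 hint)
  simp [hgK x hx]

lemma exists_null_superset_of_nonneg [LocallyCompactSpace X] [T2Space X] [BorelSpace X]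
    (hμ : E.IsEnergyMeasure μ) (hloc : E.StronglyLocal) (ha2 : E.UrysohnProperty)
    (ha3 : E.ContinuousCore) {u : E.domain} {ut : X → ℝ} (hut : E.IsQuasiContinuousVersion ut u)
    {c : ℝ} (hc : 0 ≤ c) : ∃ B, MeasurableSet B ∧ {x | ut x = c} ⊆ B ∧ μ u u B = 0 := by
  have hη : ∀ n : ℕ, (0 : ℝ≥0∞) < ((n : ℝ≥0∞) + 1)⁻¹ := fun n =>
    ENNReal.inv_pos.2 (by finiteness)
  choose G hG hGη hutG using fun n : ℕ => hut.1 _ (hη n)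
  -- Outside the exceptional set `⋂ n, G n` the level set is a countable union of closed sets.
  have hF : ∀ n, IsClosed ((G n)ᶜ ∩ ut ⁻¹' {c}) := fun n =>
    (hutG n).preimage_isClosed_of_isClosed (hG n).isClosed_compl isClosed_singleton
  have hBsub : ∀ x ∈ (⋂ n, G n) ∪ ⋃ n, ((G n)ᶜ ∩ ut ⁻¹' {c}), ∀ n, x ∈ G n ∨ ut x = c := by
    rintro x (hx | hx) n
    · exact Or.inl (mem_iInter.1 hx n)
    · obtain ⟨k, hk⟩ := mem_iUnion.1 hx
      exact Or.inr hk.2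
  have hB : MeasurableSet ((⋂ n, G n) ∪ ⋃ n, ((G n)ᶜ ∩ ut ⁻¹' {c})) :=
    (MeasurableSet.iInter fun n => (hG n).measurableSet).union
      (MeasurableSet.iUnion fun n => (hF n).measurableSet)
  refine ⟨_, hB, ?_, ?_⟩
  · intro x hx
    by_cases hxG : x ∈ ⋂ n, G n
    · exact Or.inl hxG
    · obtain ⟨n, hn⟩ := not_forall.1 (mt mem_iInter.2 hxG)
      exact Or.inr (mem_iUnion.2 ⟨n, hn, hx⟩)
  refine hμ.apply_eq_zero_of_forall_exists hB fun ε hε =>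
    E.exists_mem_energyOne_sub_lt_of_flat hc u (hμ.convex_setOf_apply_eq_zero _) ?_ hε
  intro ε hε η hη0
  obtain ⟨n, hn⟩ := ENNReal.exists_inv_nat_lt hη0.ne'
  refine ⟨G n, (hGη n).trans (lt_of_le_of_lt (ENNReal.inv_le_inv.2 le_self_add) hn), ?_⟩
  rintro v ⟨M, hM⟩ hv
  -- The flattened element is constant on this neighbourhood of the level set.
  have hU : IsOpen (G n ∪ {x | |ut x - c| < ε}) := by
    obtain ⟨V, hV, hVeq⟩ := (continuousOn_iff'.1 (hutG n)) (Metric.ball c ε) Metric.isOpen_ball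
    have : G n ∪ {x | |ut x - c| < ε} = G n ∪ V := by
      ext x
      have hx : x ∈ ut ⁻¹' Metric.ball c ε ∩ (G n)ᶜ ↔ x ∈ V ∩ (G n)ᶜ := by rw [hVeq]
      simp only [mem_inter_iff, mem_preimage, Metric.mem_ball, Real.dist_eq, mem_compl_iff] at hx
      simp only [mem_union, mem_ofPred_eq]
      tauto
    rw [this]
    exact (hG n).union hV
  have h0 := hμ.variation_eq_zero_of_ae_eq_const hloc ha2 ha3 hM hU (b := max 0 (c - ε)) (by
    filter_upwards [hv, hut.2] with x h1 h2 hx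
    rw [h2] at h1
    exact h1 (hx.imp_right fun h => le_of_lt h))
  refine (VectorMeasure.variation_apply_eq_zero hU.measurableSet).1 h0 _ (fun x hx => ?_) hB
  rcases hBsub x hx n with h | h
  · exact Or.inl h
  · refine Or.inr ?_
    simpa [h] using hε

/-- The energy measure of `u` does not charge the level sets of a quasi-continuous version of `u`. A
level set need not be measurable, so that this is stated for a measurable superset. -/
theorem exists_null_superset [LocallyCompactSpace X] [T2Space X] [BorelSpace X]
    (hμ : E.IsEnergyMeasure μ) (hloc : E.StronglyLocal) (ha2 : E.UrysohnProperty)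
    (ha3 : E.ContinuousCore) {u : E.domain} {ut : X → ℝ} (hut : E.IsQuasiContinuousVersion ut u)
    (c : ℝ) : ∃ B, MeasurableSet B ∧ {x | ut x = c} ⊆ B ∧ μ u u B = 0 := by
  rcases le_total 0 c with hc | hc
  · exact hμ.exists_null_superset_of_nonneg hloc ha2 ha3 hut hc
  have hneg : E.IsQuasiContinuousVersion (fun x => -ut x) (-u) := by
    refine ⟨fun η hη => ?_, ?_⟩
    · obtain ⟨G, hG, hGη, hutG⟩ := hut.1 η hη
      exact ⟨G, hG, hGη, hutG.neg⟩
    · filter_upwards [hut.2, E.coeFn_neg u] with x h1 h2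
      rw [h2, h1]
  obtain ⟨B, hB, hsub, h0⟩ :=
    hμ.exists_null_superset_of_nonneg hloc ha2 ha3 hneg (neg_nonneg.2 hc)
  refine ⟨B, hB, fun x hx => hsub (neg_inj.2 hx), ?_⟩
  simpa using h0

end IsEnergyMeasure

end DirichletForm

theorem mainTheorem3 {X : Type*} [TopologicalSpace X] [LocallyCompactSpace X] [T2Space X]
    [TopologicalSpace.SeparableSpace X] [MeasurableSpace X] [BorelSpace X]
    (m : Measure X) [IsFiniteMeasureOnCompacts m] [m.IsOpenPosMeasure]
    (E : DirichletForm m) (hloc : E.StronglyLocal)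
    (ha1 : E.CompactEmbedding) (ha2 : E.UrysohnProperty) (ha3 : E.ContinuousCore)
    (ψ : X → ℝ) (hψ : E.QuasiContinuous ψ)
    (f : E.domain →ₗ[ℝ] ℝ) (hf : E.IsBoundedFunctional f)
    (u : E.domain) (hu : E.IsObstacleSolution ψ f u)
    (huniq : ∀ w : E.domain, E.IsObstacleSolution ψ f w → w = u)
    (ut : X → ℝ) (hut : E.IsQuasiContinuousVersion ut u) :
    (E.EqOffSet (E.gen u) f {x | ut x = ψ x} ∧
      E.QuasiEqOffSet (E.gen u) f {x | ut x = ψ x}) ∧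
    ∀ c : ℝ, (∀ x, ψ x = c) →
      ∀ μ : E.domain →ₗ[ℝ] E.domain →ₗ[ℝ] SignedMeasure X, E.IsEnergyMeasure μ →
        ∀ v : E.domain,
          (μ u v).Integrable ({x | ut x = ψ x}.indicator (fun _ => (1 : ℝ))) ∧
          ∫ᵛ x, {x | ut x = ψ x}.indicator (fun _ => (1 : ℝ)) x ∂<•(μ u v) = 0 := by
  refine ⟨⟨hu.eqOffSet hf hψ hut, hu.quasiEqOffSet hf hψ hut⟩, fun c hc μ hμ v => ?_⟩
  simp only [hc]
  obtain ⟨B, hB, hsub, h0⟩ := hμ.exists_null_superset hloc ha2 ha3 hut c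
  have hnull : (μ u v).variation B = 0 := by
    refine (VectorMeasure.variation_apply_eq_zero hB).2 fun t htB ht => hμ.apply_eq_zero ?_ v
    have hdiff := VectorMeasure.of_add_of_sdiff (v := μ u u) ht hB htB
    linarith [hμ.nonneg u t, hμ.nonneg u (B \ t)]
  have hae : {x | ut x = c}.indicator (fun _ => (1 : ℝ)) =ᵐ[(μ u v).variation] 0 :=
    indicator_meas_zero (measure_mono_null hsub hnull)
  exact ⟨(integrable_zero X ℝ _).congr hae.symm, VectorMeasure.integral_eq_zero_of_ae hae⟩
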